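/- Let $F$ be a totally real number field of degree $n$, with ring of integers $\mathcal O_F$ and discriminant $d_F$, let $\tau_1,\dots,\tau_n$ be its embeddings into $\mathbb R$, and let $F'\subset\mathbb R$ be the field generated by $\tau_1(F),\dots,\tau_n(F)$. Let $\mathfrak a\subset F$ be a nonzero fractional ideal. For $A\subset F$ let $A_+$ be the set of totally positive elements of $A$, i.e. of the $x \in A$ with $\tau_i(x)>0$ for all $i$, let $\mathcal O_{F,+}^\times=(\mathcal O_F^\times)_+$, and put $$\zeta_{F,+}(\mathfrak a^{-1},s)=\sum_{x\in\mathfrak a_+/\mathcal O_{F,+}^\times}\frac1{N_{F/\mathbb Q}(x)^s}\qquad(\operatorname{Re}s>1).$$ A cone in $\mathbb R^n$ is a set $C_{(\alpha_1,\dots,\alpha_r)}=\sum_{i=1}^r\mathbb R_{>0}\alpha_i$ with $r\ge0$ and $\alpha_i\in\mathbb R^n\setminus\{0\}$ (it is $\{0\}$ for $r=0$). For a subfield $K\subset\mathbb R$ it is $K$-rational if the generators can be chosen in $K^n$, it is algebraic if it is $K$-rational for some subfield $K\subset\mathbb R$ algebraic over $\mathbb Q$, and it is totally positive if it is contained in $\mathbb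 R_{>0}^n$. For a totally positive cone $C$ and $\mathbf k\in\mathbb Z_{\ge1}^n$ write $|\mathbf k|=k_1+\cdots+k_n$ and $$\zeta_C(\mathbf k)=\sum_{x\in C\cap\mathbb Z^n}\frac1{x_1^{k_1}\cdots x_n^{k_n}}$$ whenever this series converges. **Theorem.** There are finitely many totally positive $F'$-rational (hence algebraic) cones $C_1,\dots,C_m\subset\mathbb R_{>0}^n$ such that for every integer $k\ge2$ all the series $\zeta_{C_i}(\mathbf k)$ with $|\mathbf k|=nk$, and the series $\zeta_{F,+}(\mathfrak a^{-1},k)$, converge and $$\zeta_{F,+}(\mathfrak a^{-1},k)\in\frac1{\sqrt{d_F}}\sum_{i=1}^m\ \sum_{\mathbf k\in\mathbb Z_{\ge1}^n,\ |\mathbf k|=nk}\mathbb Q\,\zeta_{C_i}(\mathbf k).$$ Moreover, the following explicit formula holds. Let $w=(w_1,\dots,w_n)$ be a $\mathbb Z$-basis of $\mathfrak a$, let $w^*=(w_1^*,\dots,w_n^*)$ be its dual basis for the trace form of $F/\mathbb Q$, and put $$T_{w,+}=\{x\in\mathbb R^n:\langle x,\tau_i(w)\rangle>0\ \text{for all }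 i\},\qquad N_{w^*}(y)=\prod_{i=1}^n\langle y,\tau_i(w^*)\rangle .$$ Let $\Gamma_{w,+}$ be the group of the matrices $\gamma\in SL_n(\mathbb Z)$ for which there is $u\in\mathcal O_{F,+}^\times$ with $\langle\gamma x,w\rangle=u\langle x,w\rangle$ for all $x\in\mathbb Z^n$. Let $\Phi$ be a finite set of tuples $I=(\alpha_1,\dots,\alpha_r)$, $1\le r\le n$, of vectors $\alpha_j\in C_{(\tau_1(w),\dots,\tau_n(w))}\cap\mathbb Z^n$, each tuple extendable to a basis of $\mathbb Z^n$, such that $C_{(\tau_1(w),\dots,\tau_n(w))}$ is the disjoint union of the cones ${}^t\gamma\,C_I$ with $\gamma\in\Gamma_{w,+}$ and $I\in\Phi$ (a smooth Shintani decomposition). Let $\Phi^{(n)}$ be the set of $n$-tuples in $\Phi$, regarded as matrices with columns $\alpha_j$. Then for every $I\in\Phi^{(n)}$ the set ${}^tI\,T_{w,+}$ is a totally positive $F'$-rational (hence algebraic) cone, and for every integer $k\ge2$ the coefficients $c_{I,\mathbf l}$ of $y^{\mathbf l}$ in $N_{w^*}(Iy)^{k-1}$ are rational, the series below converge, and $$\zeta_{F,+}(\mathfrak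 a^{-1},k)=\frac1{((k-1)!)^n\sqrt{d_F}\,N\mathfrak a}\sum_{I\in\Phi^{(n)}}\ \sum_{\mathbf l\in\mathbb Z_{\ge0}^n,\ |\mathbf l|=n(k-1)}l_1!\cdots l_n!\;c_{I,\mathbf l}\;\zeta_{{}^tI\,T_{w,+}}(l_1+1,\dots,l_n+1).$$ -/

import Mathlib

open scoped nonZeroDivisors
open Module NumberField

noncomputable section

namespace ConicalZeta

/-! ## Cones and conical zeta values -/

/-- The open convex polyhedral cone `∑ i, ℝ_{>0} α i` generated by a finite family of vectors
(for the empty family this is `{0}`). -/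
def coneOf {ι : Type*} [Fintype ι] {n : ℕ} (α : ι → Fin n → ℝ) : Set (Fin n → ℝ) :=
  {x | ∃ c : ι → ℝ, (∀ i, 0 < c i) ∧ x = ∑ i, c i • α i}

/-- A cone which admits finitely many nonzero generators with coordinates in the subfield `K`. -/
def IsRationalCone {n : ℕ} (K : Subfield ℝ) (C : Set (Fin n → ℝ)) : Prop :=
  ∃ (r : ℕ) (α : Fin r → Fin n → ℝ),
    (∀ i, α i ≠ 0) ∧ (∀ i j, α i j ∈ K) ∧ C = coneOf α

/-- A cone is algebraic if it is `K`-rational for a subfield `K` of `ℝ` algebraic over `ℚ`. -/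
def IsAlgebraicCone {n : ℕ} (C : Set (Fin n → ℝ)) : Prop :=
  ∃ K : Subfield ℝ, (∀ x ∈ K, IsAlgebraic ℚ x) ∧ IsRationalCone K C

/-- `C ⊆ ℝ_{>0}^n`. -/
def IsTotallyPositive {n : ℕ} (C : Set (Fin n → ℝ)) : Prop :=
  ∀ x ∈ C, ∀ i, 0 < x i

/-- The integral points of a subset of `ℝ^n`. -/
abbrev IntPoints {n : ℕ} (C : Set (Fin n → ℝ)) : Type :=
  {x : Fin n → ℤ // (fun i => (x i : ℝ)) ∈ C}

/-- The term `1 / x^𝐤` of the conical zeta series. -/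
def conicalTerm {n : ℕ} (C : Set (Fin n → ℝ)) (k : Fin n → ℕ) (x : IntPoints C) : ℝ :=
  1 / ∏ i, (x.1 i : ℝ) ^ k i

/-- The conical zeta value `ζ_C(𝐤) = ∑_{x ∈ C ∩ ℤ^n} 1 / x^𝐤`. Its convergence is asserted
separately where it is used. -/
def conicalZeta {n : ℕ} (C : Set (Fin n → ℝ)) (k : Fin n → ℕ) : ℝ :=
  ∑' x : IntPoints C, conicalTerm C k x

/-! ## The partial zeta function -/

section Field

variable (F : Type*) [Field F] [NumberField F]

/-- The compositum `F' ⊆ ℝ` of the images of all real embeddings of `F`. -/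
def compositum : Subfield ℝ := ⨆ τ : F →+* ℝ, τ.fieldRange

/-- The group of totally positive units of the ring of integers. -/
def totPosUnits : Subgroup (𝓞 F)ˣ where
  carrier := {u | ∀ τ : F →+* ℝ, 0 < τ ((u : 𝓞 F) : F)}
  one_mem' := by intro τ; simp
  mul_mem' := by
    intro u v hu hv τ
    have h := mul_pos (hu τ) (hv τ)
    rw [← map_mul] at h
    simpa using h
  inv_mem' := by
    intro u hu τ
    have h1 : τ ((u : 𝓞 F) : F) * τ (((u⁻¹ : (𝓞 F)ˣ) : 𝓞 F) : F) = 1 := by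
      rw [← map_mul, ← map_mul, Units.mul_inv, map_one, map_one]
    exact pos_of_mul_pos_right (by rw [h1]; exact one_pos) (hu τ).le

variable {F}

/-- The set `𝔞₊` of totally positive elements of a fractional ideal. -/
def totPosPart (a : FractionalIdeal (𝓞 F)⁰ F) : Set F :=
  {x | x ∈ a ∧ ∀ τ : F →+* ℝ, 0 < τ x}

/-- Two elements of `𝔞₊` are equivalent if they differ by a totally positive unit. -/
def unitSetoid (a : FractionalIdeal (𝓞 F)⁰ F) : Setoid (totPosPart a) where
  r x y := ∃ u ∈ totPosUnits F, (y : F) = ((u : 𝓞 F) : F) * x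
  iseqv :=
    { refl := fun x => ⟨1, one_mem _, by simp⟩
      symm := by
        rintro x y ⟨u, hu, h⟩
        refine ⟨u⁻¹, inv_mem hu, ?_⟩
        rw [h, ← mul_assoc, ← map_mul, Units.inv_mul, map_one, one_mul]
      trans := by
        rintro x y z ⟨u, hu, h⟩ ⟨v, hv, h'⟩
        refine ⟨v * u, mul_mem hv hu, ?_⟩
        rw [h', h, ← mul_assoc, ← map_mul, Units.val_mul] }

theorem norm_pos_of_totPos [IsTotallyReal F] {x : F} (hx : ∀ τ : F →+* ℝ, 0 < τ x) :
    0 < Algebra.norm ℚ x := by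
  have key : ((Algebra.norm ℚ x : ℚ) : ℂ) =
      ((∏ φ : F →ₐ[ℚ] ℂ, (IsTotallyReal.complexEmbedding_isReal φ.toRingHom).embedding x : ℝ) :
        ℂ) := by
    have h := Algebra.norm_eq_prod_embeddings ℚ ℂ x
    rw [eq_ratCast] at h
    rw [h, Complex.ofReal_prod]
    refine Finset.prod_congr rfl fun φ _ => ?_
    exact (ComplexEmbedding.IsReal.coe_embedding_apply
      (IsTotallyReal.complexEmbedding_isReal φ.toRingHom) x).symm
  have key' : ((Algebra.norm ℚ x : ℚ) : ℝ) =
      ∏ φ : F →ₐ[ℚ] ℂ, (IsTotallyReal.complexEmbedding_isReal φ.toRingHom).embedding x := by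
    exact_mod_cast key
  have : (0 : ℝ) < ((Algebra.norm ℚ x : ℚ) : ℝ) := by
    rw [key']
    exact Finset.prod_pos fun φ _ => hx _
  exact_mod_cast this

theorem norm_totPosUnit [IsTotallyReal F] {u : (𝓞 F)ˣ} (hu : u ∈ totPosUnits F) :
    Algebra.norm ℚ ((u : 𝓞 F) : F) = 1 := by
  have h1 := NumberField.isUnit_iff_norm.mp u.isUnit
  rw [RingOfIntegers.coe_norm] at h1
  rwa [abs_of_pos (norm_pos_of_totPos hu)] at h1

variable [IsTotallyReal F]

/-- The term `1 / N_{F/ℚ}(x)^s`, as a function on `𝔞₊ / 𝓞_{F,+}^×`. -/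
def partialZetaTerm (a : FractionalIdeal (𝓞 F)⁰ F) (s : ℂ) (q : Quotient (unitSetoid a)) : ℂ :=
  Quotient.lift (s := unitSetoid a)
    (fun x : totPosPart a => 1 / ((Algebra.norm ℚ (x : F) : ℚ) : ℂ) ^ s)
    (by
      rintro x y ⟨u, hu, h⟩
      simp only [h, map_mul, norm_totPosUnit hu, one_mul]) q

/-- The narrow partial zeta function `ζ_{F,+}(𝔞⁻¹, s) = ∑_{x ∈ 𝔞₊ / 𝓞_{F,+}^×} 1 / N_{F/ℚ}(x)^s`
in the half plane `Re s > 1`. The argument of the definition is `𝔞`, not `𝔞⁻¹`. -/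
def partialZeta (a : FractionalIdeal (𝓞 F)⁰ F) (s : ℂ) : ℂ :=
  ∑' q : Quotient (unitSetoid a), partialZetaTerm a s q

end Field

/-! ## The objects in the explicit formula -/

section Explicit

variable {F : Type*} [Field F] [NumberField F] {n : ℕ}

/-- `w` is a basis of the fractional ideal `𝔞` over `ℤ`. -/
def IsIntBasis (a : FractionalIdeal (𝓞 F)⁰ F) (w : Fin n → F) : Prop :=
  LinearIndependent ℤ w ∧ ∀ x : F, x ∈ a ↔ x ∈ Submodule.span ℤ (Set.range w)

/-- `v` is the dual family of `w` for the trace form of `F/ℚ`. -/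
def IsTraceDual (w v : Fin n → F) : Prop :=
  ∀ i j, Algebra.trace ℚ F (w i * v j) = if i = j then 1 else 0

/-- The vectors `τ(w) = (τ(w_1), …, τ(w_n))`, indexed by the real embeddings `τ` of `F`. -/
def embVec (w : Fin n → F) (τ : F →+* ℝ) : Fin n → ℝ := fun i => τ (w i)

/-- `T_{w,+}`: all `x ∈ ℝ^n` with `⟨x, τ(w)⟩ > 0` for every real embedding `τ`. -/
def posCone (w : Fin n → F) : Set (Fin n → ℝ) :=
  {x | ∀ τ : F →+* ℝ, 0 < ∑ i, x i * τ (w i)}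

/-- The group `Γ_{w,+}`, as a set of integer matrices: the matrices `γ` of multiplication by a
totally positive unit `u`, i.e. `⟨γ x, w⟩ = u ⟨x, w⟩` for all `x`. -/
def unitMatrices (w : Fin n → F) : Set (Matrix (Fin n) (Fin n) ℤ) :=
  {γ | ∃ u ∈ totPosUnits F, ∀ x : Fin n → ℤ,
    ∑ i, ((γ.mulVec x) i : F) * w i = ((u : 𝓞 F) : F) * ∑ i, (x i : F) * w i}

/-- A tuple `(α_1, …, α_r)` of vectors in `ℤ^n` (with its length `r`). -/
abbrev IntTuple (n : ℕ) : Type := Σ r : ℕ, Fin r → Fin n → ℤ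

/-- The cone in `ℝ^n` generated by a tuple of integral vectors. -/
def intCone (I : IntTuple n) : Set (Fin n → ℝ) := coneOf fun j i => (I.2 j i : ℝ)

/-- The translate `ᵗγ C` of a subset `C` of `ℝ^n`. -/
def coneTranslate (γ : Matrix (Fin n) (Fin n) ℤ) (C : Set (Fin n → ℝ)) : Set (Fin n → ℝ) :=
  (fun y => ((γ.map (Int.cast : ℤ → ℝ)).transpose).mulVec y) '' C

/-- A finite set `Φ` of tuples of vectors in `ℤ^n`, all lying in the cone generated by the vectors
`τ(w)`, is a (smooth) Shintani cone decomposition if every tuple extends to a basis of `ℤ^n` and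
the cones `ᵗγ C_I`, for `γ ∈ Γ_{w,+}` and `I ∈ Φ`, form a partition of that cone. -/
structure IsShintaniDecomposition (w : Fin n → F) (Φ : Finset (IntTuple n)) : Prop where
  length : ∀ I ∈ Φ, 1 ≤ I.1 ∧ I.1 ≤ n
  mem_cone : ∀ I ∈ Φ, ∀ j, (fun i => (I.2 j i : ℝ)) ∈ coneOf (embVec w)
  smooth : ∀ I ∈ Φ, ∃ (b : Basis (Fin n) ℤ (Fin n → ℤ)) (e : Fin I.1 ↪ Fin n),
    ∀ j, I.2 j = b (e j)
  cover : coneOf (embVec w) = ⋃ γ ∈ unitMatrices w, ⋃ I ∈ Φ, coneTranslate γ (intCone I)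
  disjoint : ∀ γ ∈ unitMatrices w, ∀ I ∈ Φ, ∀ γ' ∈ unitMatrices w, ∀ I' ∈ Φ,
    (γ, I) ≠ (γ', I') → Disjoint (coneTranslate γ (intCone I)) (coneTranslate γ' (intCone I'))

/-- The subset `Φ^{(n)}` of the `n`-tuples in `Φ`. -/
def topPart (Φ : Finset (IntTuple n)) : Finset (Fin n → Fin n → ℤ) :=
  Φ.preimage (fun I => (⟨n, I⟩ : IntTuple n)) (sigma_mk_injective (β := fun r => Fin r → Fin n → ℤ)).injOn

/-- The set `ᵗI T_{w,+} = {(⟨α_1, x⟩, …, ⟨α_n, x⟩) : x ∈ T_{w,+}}`, where `I = (α_1, …, α_n)` is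
regarded as the matrix with columns `α_j`. -/
def dualCone (w : Fin n → F) (I : Fin n → Fin n → ℤ) : Set (Fin n → ℝ) :=
  (fun x j => ∑ i, (I j i : ℝ) * x i) '' posCone w

/-- The polynomial `N_v(I y) = ∏_τ ⟨I y, τ(v)⟩` in the variables `y_1, …, y_n`, where `I` is
regarded as the matrix with columns `I j`. -/
def normPoly (v : Fin n → F) (I : Fin n → Fin n → ℤ) : MvPolynomial (Fin n) ℝ :=
  ∏ τ : F →+* ℝ, ∑ i, MvPolynomial.C (τ (v i)) *
    ∑ j, MvPolynomial.C (I j i : ℝ) * MvPolynomial.X j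

/-- The coefficient of `y^l` in `N_v(I y)^(k-1)` (used for `k ≥ 2`). -/
def normCoeff (v : Fin n → F) (I : Fin n → Fin n → ℤ) (k : ℕ) (l : Fin n → ℕ) : ℝ :=
  MvPolynomial.coeff (Finsupp.equivFunOnFinite.symm l) (normPoly v I ^ (k - 1))

end Explicit

end ConicalZeta

end

set_option linter.unusedSectionVars false

noncomputable section

namespace ConicalZeta

open MeasureTheory Set
open scoped ENNReal

/-! ### Real embeddings, trace duality and discriminants. -/

section RealEmbeddings

variable {F : Type*} [Field F] [NumberField F] [IsTotallyReal F]

/-! For totally positive `x`, Euler's integral gives `((k-1)!)^n / N(x)^k = ∫ N(t)^(k-1) exp(-⟨t,x⟩)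
dt`, taken over the positive orthant of `ℝ ⊗ F` (`lintegral_kernel_orthant`). Suppose the translates
of finitely many open simplicial cones under the totally positive units cover almost every point of
the orthant with total weight one. Since these units have norm one, the integral over a translate by
`u` equals the integral over the original cone with `x` replaced by `u⁻¹x`
(`lintegral_kernel_unit`). Summing over `𝔞₊` modulo units and over all units then unfolds to a sum
over all of `𝔞₊`, with one integral per cone (`tsum_lintegral_orthant`).

On a cone whose generators `v` are dual to a `ℤ`-basis `w` of `𝔞`, put `t = ∑ z_j v_j` and `x = ∑
m_j w_j`. The Jacobian is `1/(√d_F N𝔞)`, the exponent is `-∑ m_j z_j`, and `N(t)^(k-1)` becomes a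
polynomial in `z` with rational coefficients. Integrating each monomial gives `l!/m^(l+1)`. As `x`
runs through `𝔞₊`, `m` runs through the integral points of `posCone w`, so conical zeta values
appear (`tsum_lintegral_kernel_dualRegion`). All integrands are nonnegative, so sums and integrals
are exchanged in `ℝ≥0∞`, and summability of the partial zeta series follows from finiteness of the
other side.

The explicit formula uses the full-dimensional cones of the given Shintani decomposition. The
smaller cones lie in hyperplanes `⟨t,c⟩ = 0` with `c ∈ F`, which are null sets.

For the first assertion no honest decomposition is constructed. Dirichlet's unit theorem and
compactness give a finite cover (`exists_finite_cover`). Star subdivisions refine it until the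
covering multiplicity is constant on each piece and each piece is unimodular
(`subdivides_coverCount_const`). Weighting each piece by the inverse of its multiplicity is enough,
because the weights are rational. -/

variable (F) in
/-- The real embeddings of a totally real field, as embeddings into `ℂ`. -/
def realEmbEquiv : (F →+* ℝ) ≃ (F →ₐ[ℚ] ℂ) where
  toFun τ := (Complex.ofRealHom.comp τ).toRatAlgHom
  invFun φ := (IsTotallyReal.complexEmbedding_isReal φ.toRingHom).embedding
  left_inv τ := by
    ext x
    exact Complex.ofReal_injective (ComplexEmbedding.IsReal.coe_embedding_apply
      (IsTotallyReal.complexEmbedding_isReal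
        ((Complex.ofRealHom.comp τ).toRatAlgHom : F →ₐ[ℚ] ℂ).toRingHom) x)
  right_inv φ := by
    ext x
    exact ComplexEmbedding.IsReal.coe_embedding_apply
      (IsTotallyReal.complexEmbedding_isReal φ.toRingHom) x

theorem realEmbEquiv_apply (τ : F →+* ℝ) (x : F) : realEmbEquiv F τ x = ((τ x : ℝ) : ℂ) := rfl

theorem prod_realEmb (x : F) : ∏ τ : F →+* ℝ, τ x = ((Algebra.norm ℚ x : ℚ) : ℝ) := by
  have h := Algebra.norm_eq_prod_embeddings ℚ ℂ x
  rw [eq_ratCast, ← (realEmbEquiv F).prod_comp] at h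
  simp only [realEmbEquiv_apply] at h
  exact_mod_cast h.symm

theorem sum_realEmb (x : F) : ∑ τ : F →+* ℝ, τ x = ((Algebra.trace ℚ F x : ℚ) : ℝ) := by
  have h := trace_eq_sum_embeddings (K := ℚ) (L := F) ℂ (x := x)
  rw [eq_ratCast, ← (realEmbEquiv F).sum_comp] at h
  simp only [realEmbEquiv_apply] at h
  exact_mod_cast h.symm

variable (F) in
theorem card_realEmb : Fintype.card (F →+* ℝ) = finrank ℚ F := by
  rw [Fintype.card_congr (realEmbEquiv F), AlgHom.card]

instance : Nonempty (F →+* ℝ) := by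
  rw [← Fintype.card_pos_iff, card_realEmb]
  exact finrank_pos

/-- The pairing `⟨t, c⟩ = ∑ τ, t_τ τ(c)` between `ℝ ⊗ F` and `F`. -/
def pair (t : (F →+* ℝ) → ℝ) (c : F) : ℝ := ∑ τ, t τ * τ c

theorem pair_add (t : (F →+* ℝ) → ℝ) (c d : F) : pair t (c + d) = pair t c + pair t d := by
  simp [pair, mul_add, Finset.sum_add_distrib]

theorem pair_ratCast_mul (t : (F →+* ℝ) → ℝ) (q : ℚ) (c : F) :
    pair t ((q : F) * c) = (q : ℝ) * pair t c := by
  simp only [pair, map_mul, map_ratCast, Finset.mul_sum]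
  exact Finset.sum_congr rfl fun τ _ => by ring

theorem pair_sum {ι : Type*} (s : Finset ι) (t : (F →+* ℝ) → ℝ) (c : ι → F) :
    pair t (∑ i ∈ s, c i) = ∑ i ∈ s, pair t (c i) := by
  simp only [pair, map_sum, Finset.mul_sum]
  exact Finset.sum_comm

variable {n : ℕ} {w v : Fin n → F}

theorem IsTraceDual.symm (h : IsTraceDual w v) : IsTraceDual v w := by
  intro i j
  rw [mul_comm, h j i]
  simp only [eq_comm]

theorem IsTraceDual.sum_embeddings (h : IsTraceDual w v) (i j : Fin n) :
    ∑ τ : F →+* ℝ, τ (w i) * τ (v j) = if i = j then 1 else 0 := by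
  simp only [← map_mul]
  rw [sum_realEmb, h]
  split_ifs <;> simp

-- Duality says `A * B = 1` for the square matrices of embeddings of `w` and `v`. This is the
-- relation `B * A = 1`, and it is where the equality of `n` with the degree enters.
open scoped Classical in
theorem IsTraceDual.sum_index (h : IsTraceDual w v) (hn : finrank ℚ F = n) (σ τ : F →+* ℝ) :
    ∑ j, σ (v j) * τ (w j) = if σ = τ then 1 else 0 := by
  have e : Fin n ≃ (F →+* ℝ) := (Fintype.equivFinOfCardEq ((card_realEmb F).trans hn)).symm
  let A : Matrix (Fin n) (Fin n) ℝ := fun i j => e j (w i)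
  let B : Matrix (Fin n) (Fin n) ℝ := fun j i => e j (v i)
  have hAB : A * B = 1 := by
    ext i j
    rw [Matrix.mul_apply, e.sum_comp (fun τ => τ (w i) * τ (v j)), h.sum_embeddings,
      Matrix.one_apply]
  have hBA := mul_eq_one_comm.mp hAB
  have := congrFun (congrFun hBA (e.symm σ)) (e.symm τ)
  rw [Matrix.mul_apply, Matrix.one_apply] at this
  simpa [A, B] using this

theorem IsTraceDual.eq_sum (h : IsTraceDual w v) (hn : finrank ℚ F = n) (x : F) :
    x = ∑ j, ((Algebra.trace ℚ F (x * v j) : ℚ) : F) * w j := by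
  obtain ⟨σ⟩ : Nonempty (F →+* ℝ) := inferInstance
  apply σ.injective
  simp only [map_sum, map_mul, map_ratCast, ← sum_realEmb, Finset.sum_mul]
  rw [Finset.sum_comm]
  have (τ : F →+* ℝ) : ∑ j, τ x * τ (v j) * σ (w j) = τ x * ∑ j, τ (v j) * σ (w j) := by
    rw [Finset.mul_sum]
    exact Finset.sum_congr rfl fun j _ => by ring
  classical
  simp [this, h.sum_index hn]

theorem IsTraceDual.pair_eq (h : IsTraceDual w v) (hn : finrank ℚ F = n)
    (t : (F →+* ℝ) → ℝ) (x : F) :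
    pair t x = ∑ j, ((Algebra.trace ℚ F (x * v j) : ℚ) : ℝ) * pair t (w j) := by
  conv_lhs => rw [h.eq_sum hn x]
  rw [pair_sum]
  simp only [pair_ratCast_mul]

theorem IsTraceDual.apply_eq (h : IsTraceDual w v) (hn : finrank ℚ F = n)
    (t : (F →+* ℝ) → ℝ) (τ : F →+* ℝ) : t τ = ∑ j, pair t (w j) * τ (v j) := by
  simp only [pair, Finset.sum_mul]
  rw [Finset.sum_comm]
  have (σ : F →+* ℝ) : ∑ j, t σ * σ (w j) * τ (v j) = t σ * ∑ j, τ (v j) * σ (w j) := by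
    rw [Finset.mul_sum]
    exact Finset.sum_congr rfl fun j _ => by ring
  classical
  simp [this, h.sum_index hn]

theorem IsTraceDual.pair_combination (h : IsTraceDual w v) (z : Fin n → ℝ) (i : Fin n) :
    pair (fun τ => ∑ j, z j * τ (v j)) (w i) = z i := by
  simp only [pair, Finset.sum_mul]
  rw [Finset.sum_comm]
  have (j : Fin n) : ∑ τ : F →+* ℝ, z j * τ (v j) * τ (w i) =
      z j * ∑ τ : F →+* ℝ, τ (w i) * τ (v j) := by
    rw [Finset.mul_sum]
    exact Finset.sum_congr rfl fun j _ => by ring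
  simp [this, h.sum_embeddings]

theorem IsTraceDual.linearIndependent (h : IsTraceDual w v) : LinearIndependent ℚ w := by
  rw [Fintype.linearIndependent_iff]
  intro g hg i
  have := congrArg (fun x => Algebra.trace ℚ F (x * v i)) hg
  simpa [Finset.sum_mul, h _ i] using this

theorem exists_isTraceDual (b : Basis (Fin n) ℚ F) : ∃ v : Fin n → F, IsTraceDual b v :=
  ⟨b.traceDual, fun i j => b.trace_mul_traceDual i j⟩

/-- The trace matrix factors as `Mᵗ M` with `M` the matrix of embeddings, because the trace is the
sum over the real embeddings. -/
theorem det_embeddings_sq (e : Fin n ≃ (F →+* ℝ)) (w : Fin n → F) :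
    (Matrix.of fun i j => e i (w j)).det ^ 2 = ((Algebra.discr ℚ w : ℚ) : ℝ) := by
  rw [sq]
  nth_rewrite 1 [← Matrix.det_transpose]
  rw [← Matrix.det_mul, Algebra.discr_def]
  have : (((Algebra.traceMatrix ℚ w).det : ℚ) : ℝ) =
      ((Algebra.traceMatrix ℚ w).map (Rat.cast : ℚ → ℝ)).det := by
    simpa using (RingHom.map_det (Rat.castHom ℝ) (Algebra.traceMatrix ℚ w))
  rw [this]
  congr 1
  ext i j
  rw [Matrix.mul_apply]
  simp only [Matrix.transpose_apply, Matrix.of_apply, Matrix.map_apply, Algebra.traceMatrix_apply,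
    Algebra.traceForm_apply]
  rw [e.sum_comp (fun τ => τ (w i) * τ (w j)), ← sum_realEmb]
  simp

theorem abs_det_mul_abs_det_dual (e : Fin n ≃ (F →+* ℝ)) (h : IsTraceDual w v) :
    |(Matrix.of fun i j => e i (w j)).det| * |(Matrix.of fun i j => e i (v j)).det| = 1 := by
  rw [← abs_mul, ← Matrix.det_transpose, ← Matrix.det_mul]
  have : (Matrix.of fun i j => e i (w j)).transpose * (Matrix.of fun i j => e i (v j)) = 1 := by
    ext i j
    rw [Matrix.mul_apply]
    simp only [Matrix.transpose_apply, Matrix.of_apply]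
    rw [e.sum_comp (fun τ => τ (w i) * τ (v j)), h.sum_embeddings, Matrix.one_apply]
  rw [this]
  simp

/-! ### Integral bases of fractional ideals. -/

variable {a : FractionalIdeal (𝓞 F)⁰ F}

/-- The integral basis of `𝔞` as a `ℤ`-basis of the module `𝔞`. -/
def IsIntBasis.basis (h : IsIntBasis a w) : Basis (Fin n) ℤ a :=
  (Basis.span h.1).map (LinearEquiv.ofEq _ ((a : Submodule (𝓞 F) F).restrictScalars ℤ)
    (by ext x; exact (h.2 x).symm))

theorem IsIntBasis.basis_apply (h : IsIntBasis a w) (i : Fin n) : (h.basis i : F) = w i := by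
  change (Basis.span h.1 i : F) = w i
  rw [Basis.span_apply]

theorem IsIntBasis.mem (h : IsIntBasis a w) (i : Fin n) : w i ∈ a :=
  (h.2 _).mpr (Submodule.subset_span ⟨i, rfl⟩)

/-- Compare with an integral basis of `𝓞 F`: the discriminant changes by the square of the
base-change determinant, whose absolute value is the ideal norm. -/
theorem IsIntBasis.discr_eq (h : IsIntBasis a w) (hn : finrank ℚ F = n) :
    Algebra.discr ℚ w = (discr F : ℚ) * FractionalIdeal.absNorm a ^ 2 := by
  have hc : finrank ℤ (𝓞 F) = n := by rw [RingOfIntegers.rank, hn]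
  let b : Basis (Fin n) ℤ (𝓞 F) := (RingOfIntegers.basis F).reindex
    (Fintype.equivFinOfCardEq (by rw [← finrank_eq_card_chooseBasisIndex, hc]))
  let b' := b.localizationLocalization ℚ ℤ⁰ F
  have key := FractionalIdeal.abs_det_basis_change b a h.basis
  have hw : ((↑) ∘ h.basis : Fin n → F) = w := funext h.basis_apply
  rw [hw] at key
  have h2 : Algebra.discr ℚ w = (b'.det w) ^ 2 * Algebra.discr ℚ b' := by
    rw [Basis.det_apply, ← Algebra.discr_of_matrix_vecMul]
    congr 1
    ext i
    conv_lhs => rw [← b'.sum_repr (w i)]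
    simp [Matrix.vecMul, dotProduct, Matrix.map_apply, Basis.toMatrix_apply, mul_comm,
      Algebra.smul_def, b']
  have h3 : Algebra.discr ℚ b' = discr F := by
    rw [← discr_eq_discr F b]
    exact (Algebra.discr_localizationLocalization ℤ ℤ⁰ F b)
  rw [h2, ← sq_abs, key, h3, mul_comm]

theorem IsIntBasis.discr_pos (h : IsIntBasis a w) (hd : IsTraceDual w v)
    (hn : finrank ℚ F = n) : 0 < (discr F : ℝ) := by
  have e : Fin n ≃ (F →+* ℝ) := (Fintype.equivFinOfCardEq ((card_realEmb F).trans hn)).symm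
  have h1 := det_embeddings_sq e w
  have h2 := abs_det_mul_abs_det_dual e hd
  have h3 : (0 : ℝ) < (Matrix.of fun i j => e i (w j)).det ^ 2 := by
    apply sq_pos_of_ne_zero
    intro h0
    simp [h0] at h2
  rw [h1, h.discr_eq hn] at h3
  push_cast at h3
  by_contra! h4
  have h5 : (0 : ℝ) ≤ ((FractionalIdeal.absNorm a : ℚ) : ℝ) ^ 2 := sq_nonneg _
  nlinarith

/-- This Jacobian is the source of the factor `1/(√d_F N𝔞)` in the formula. -/
theorem IsIntBasis.abs_det_dual (h : IsIntBasis a w) (hd : IsTraceDual w v)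
    (hn : finrank ℚ F = n) (e : Fin n ≃ (F →+* ℝ)) :
    |(Matrix.of fun i j => e i (v j)).det| =
      1 / (√(discr F : ℝ) * ((FractionalIdeal.absNorm a : ℚ) : ℝ)) := by
  have h1 : |(Matrix.of fun i j => e i (w j)).det| =
      √(discr F : ℝ) * ((FractionalIdeal.absNorm a : ℚ) : ℝ) := by
    rw [← Real.sqrt_sq_eq_abs, det_embeddings_sq, h.discr_eq hn]
    push_cast
    have h5 : (0 : ℝ) ≤ ((FractionalIdeal.absNorm a : ℚ) : ℝ) := by
      exact_mod_cast FractionalIdeal.absNorm_nonneg a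
    rw [Real.sqrt_mul (h.discr_pos hd hn).le, Real.sqrt_sq h5]
  have h2 := abs_det_mul_abs_det_dual e hd
  rw [h1] at h2
  rw [one_div]
  exact eq_inv_of_mul_eq_one_right h2

theorem exists_isIntBasis (ha : a ≠ 0) (hn : finrank ℚ F = n) :
    ∃ w : Fin n → F, IsIntBasis a w := by
  let I : (FractionalIdeal (𝓞 F)⁰ F)ˣ := Units.mk0 a ha
  have hc : Fintype.card (Free.ChooseBasisIndex ℤ I) = n := by
    rw [← hn, finrank_eq_card_basis (basisOfFractionalIdeal F I)]
  let b := (basisOfFractionalIdeal F I).reindex (Fintype.equivFinOfCardEq hc)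
  refine ⟨b, b.linearIndependent.restrict_scalars' ℤ, fun x => ?_⟩
  have := mem_span_basisOfFractionalIdeal F (I := I) (x := x)
  rw [Basis.range_reindex, this]
  rfl

theorem exists_dual_of_isIntBasis (h : IsIntBasis a w) (hn : finrank ℚ F = n) :
    ∃ v : Fin n → F, IsTraceDual w v := by
  have : Nonempty (Fin n) := ⟨⟨0, hn ▸ finrank_pos⟩⟩
  have hli : LinearIndependent ℚ w :=
    (LinearIndependent.iff_fractionRing (R := ℤ) (K := ℚ)).mp h.1
  obtain ⟨v, hv⟩ := exists_isTraceDual (basisOfLinearIndependentOfCardEqFinrank hli (by simp [hn]))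
  exact ⟨v, by simpa using hv⟩

end RealEmbeddings

/-! ### Gamma integrals over an orthant and linear changes of variables. -/

section Integrals

theorem integrableOn_pow_mul_exp {a : ℝ} (ha : 0 < a) (l : ℕ) :
    IntegrableOn (fun z : ℝ => z ^ l * Real.exp (-(a * z))) (Ioi 0) := by
  have h := (integrableOn_rpow_mul_exp_neg_mul_rpow (s := (l : ℝ)) (p := 1) (b := a)
    (by have := l.cast_nonneg (α := ℝ); linarith) one_pos ha)
  refine h.congr_fun (fun z _ => ?_) measurableSet_Ioi
  simp

theorem integral_pow_mul_exp {a : ℝ} (ha : 0 < a) (l : ℕ) :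
    ∫ z in Ioi (0 : ℝ), z ^ l * Real.exp (-(a * z)) = (l.factorial : ℝ) / a ^ (l + 1) := by
  have h := Real.integral_rpow_mul_exp_neg_mul_Ioi (a := (l : ℝ) + 1) (r := a) (by positivity) ha
  rw [Real.Gamma_nat_eq_factorial] at h
  simp only [add_sub_cancel_right, Real.rpow_natCast] at h
  rw [h, one_div, ← Nat.cast_add_one, Real.rpow_natCast, inv_pow]
  field_simp

variable {ι : Type*} [Fintype ι]

theorem volume_restrict_orthant :
    (volume : Measure (ι → ℝ)).restrict {z | ∀ j, 0 < z j} =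
      Measure.pi fun _ => (volume : Measure ℝ).restrict (Ioi 0) := by
  have : {z : ι → ℝ | ∀ j, 0 < z j} = Set.pi univ fun _ => Ioi (0 : ℝ) := by
    ext z; simp
  rw [this, volume_pi, Measure.restrict_pi_pi]

theorem measurableSet_orthant : MeasurableSet {z : ι → ℝ | ∀ j, 0 < z j} := by
  have : {z : ι → ℝ | ∀ j, 0 < z j} = Set.pi univ fun _ => Ioi (0 : ℝ) := by
    ext z; simp
  rw [this]
  exact MeasurableSet.univ_pi fun _ => measurableSet_Ioi

theorem integrableOn_monomial {a : ι → ℝ} (ha : ∀ j, 0 < a j) (l : ι → ℕ) :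
    IntegrableOn (fun z : ι → ℝ => ∏ j, z j ^ l j * Real.exp (-(a j * z j)))
      {z | ∀ j, 0 < z j} := by
  rw [IntegrableOn, volume_restrict_orthant]
  exact Integrable.fintype_prod fun j => integrableOn_pow_mul_exp (ha j) (l j)

theorem integral_monomial {a : ι → ℝ} (ha : ∀ j, 0 < a j) (l : ι → ℕ) :
    ∫ z in {z : ι → ℝ | ∀ j, 0 < z j}, ∏ j, z j ^ l j * Real.exp (-(a j * z j)) =
      ∏ j, ((l j).factorial : ℝ) / a j ^ (l j + 1) := by
  rw [volume_restrict_orthant,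
    integral_fintype_prod_eq_prod (fun j (z : ℝ) => z ^ l j * Real.exp (-(a j * z)))]
  exact Finset.prod_congr rfl fun j _ => integral_pow_mul_exp (ha j) (l j)

/-- Only the total polynomial is assumed nonnegative on the orthant, so the monomials are separated
in the Bochner integral and the result is carried back to `∫⁻`. -/
theorem lintegral_polynomial (p : MvPolynomial ι ℝ)
    (hp : ∀ z : ι → ℝ, (∀ j, 0 < z j) → 0 ≤ MvPolynomial.eval z p)
    {a : ι → ℝ} (ha : ∀ j, 0 < a j) :
    ∫⁻ z in {z : ι → ℝ | ∀ j, 0 < z j},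
        ENNReal.ofReal (MvPolynomial.eval z p * Real.exp (-∑ j, a j * z j)) =
      ENNReal.ofReal (∑ m ∈ p.support, p.coeff m *
        ∏ j, ((m j).factorial : ℝ) / a j ^ (m j + 1)) := by
  have hexp (z : ι → ℝ) : MvPolynomial.eval z p * Real.exp (-∑ j, a j * z j) =
      ∑ m ∈ p.support, p.coeff m * ∏ j, z j ^ m j * Real.exp (-(a j * z j)) := by
    rw [MvPolynomial.eval_eq', Finset.sum_mul]
    refine Finset.sum_congr rfl fun m _ => ?_
    rw [Finset.prod_mul_distrib, ← Real.exp_sum, Finset.sum_neg_distrib]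
    ring
  rw [← ofReal_integral_eq_lintegral_ofReal]
  · simp only [hexp]
    rw [integral_finsetSum]
    · congr 1
      refine Finset.sum_congr rfl fun m _ => ?_
      rw [integral_const_mul, integral_monomial ha]
    · exact fun m _ => (integrableOn_monomial ha m).const_mul _
  · simp only [hexp]
    exact integrable_finsetSum _ fun m _ => (integrableOn_monomial ha m).const_mul _
  · filter_upwards [ae_restrict_mem measurableSet_orthant] with z hz
    exact mul_nonneg (hp z hz) (Real.exp_pos _).le

/-- Linear change of variables between two spaces of functions on finite types of the same
cardinality. -/
theorem lintegral_linear_change {κ : Type*} [Fintype κ] [DecidableEq κ] (e : κ ≃ ι)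
    (A : ι → κ → ℝ) (hA : (Matrix.of fun i j => A (e i) j).det ≠ 0) (s : Set (κ → ℝ))
    (hs : MeasurableSet s) (f : (ι → ℝ) → ℝ≥0∞) :
    ∫⁻ t in (fun z i => ∑ j, z j * A i j) '' s, f t =
      ENNReal.ofReal |(Matrix.of fun i j => A (e i) j).det| *
        ∫⁻ z in s, f (fun i => ∑ j, z j * A i j) := by
  let B := Matrix.of fun i j => A (e i) j
  let g : (κ → ℝ) →L[ℝ] (κ → ℝ) := LinearMap.toContinuousLinearMap (Matrix.toLin' B)
  have hdet : g.det = B.det := by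
    change LinearMap.det (Matrix.toLin' B) = _
    rw [LinearMap.det_toLin']
  let E : (κ → ℝ) ≃ᵐ (ι → ℝ) := MeasurableEquiv.piCongrLeft (fun _ => ℝ) e
  have hE : MeasurePreserving E volume volume := volume_measurePreserving_piCongrLeft _ e
  have hcomp (z : κ → ℝ) : (fun i => ∑ j, z j * A i j) = E (g z) := by
    ext i
    obtain ⟨k, rfl⟩ := e.surjective i
    change _ = (Equiv.piCongrLeft (fun _ => ℝ) e) (g z) (e k)
    rw [Equiv.piCongrLeft_apply_apply]
    change _ = (Matrix.toLin' B z) k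
    simp [Matrix.mulVec, dotProduct, B, mul_comm]
  simp only [hcomp]
  have himage : (fun z => E (g z)) '' s = E '' (g '' s) := by rw [image_image]
  have hinj : Function.Injective g := by
    change Function.Injective B.mulVec
    exact Matrix.mulVec_injective_iff_isUnit.mpr
      ((Matrix.isUnit_iff_isUnit_det _).mpr (Ne.isUnit hA))
  rw [himage, ← hE.setLIntegral_comp_emb E.measurableEmbedding,
    lintegral_image_eq_lintegral_abs_det_fderiv_mul volume hs
    (fun z _ => g.hasFDerivAt.hasFDerivWithinAt) hinj.injOn, hdet,
    lintegral_const_mul' _ _ ENNReal.ofReal_ne_top]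

end Integrals

/-! ### The kernel integrated over the orthant and over a simplicial cone. -/

section FieldIntegrals

variable {F : Type*} [Field F] [NumberField F] [IsTotallyReal F] {n : ℕ} {w v : Fin n → F}

variable (F) in
/-- The totally positive orthant of `ℝ ⊗ F`. -/
def orthant : Set ((F →+* ℝ) → ℝ) := {t | ∀ τ, 0 < t τ}

/-- The cone of all `t` such that `⟨t, w_j⟩ > 0` for all `j`. -/
def dualRegion (w : Fin n → F) : Set ((F →+* ℝ) → ℝ) := {t | ∀ j, 0 < pair t (w j)}

theorem continuous_pair (c : F) : Continuous fun t => pair t c := by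
  unfold pair
  fun_prop

theorem measurableSet_dualRegion (w : Fin n → F) : MeasurableSet (dualRegion w) := by
  have : dualRegion w = ⋂ j, {t | 0 < pair t (w j)} := by
    ext t; simp [dualRegion]
  rw [this]
  exact MeasurableSet.iInter fun j => (isOpen_lt continuous_const (continuous_pair _)).measurableSet

/-- The numbers `⟨t, w_j⟩` are the coordinates of `t` in the basis `v`, so the region is the open
simplicial cone generated by `v`. -/
theorem dualRegion_eq_image (h : IsTraceDual w v) (hn : finrank ℚ F = n) :
    dualRegion w = (fun z τ => ∑ j, z j * τ (v j)) '' {z : Fin n → ℝ | ∀ j, 0 < z j} := by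
  ext t
  constructor
  · intro ht
    exact ⟨fun j => pair t (w j), ht, funext fun τ => (h.apply_eq hn t τ).symm⟩
  · rintro ⟨z, hz, rfl⟩ j
    rw [h.pair_combination]
    exact hz j

theorem dualRegion_subset_orthant (h : IsTraceDual w v) (hn : finrank ℚ F = n)
    (hv : ∀ j (τ : F →+* ℝ), 0 < τ (v j)) : dualRegion w ⊆ orthant F := by
  intro t ht τ
  rw [h.apply_eq hn t τ]
  have : Nonempty (Fin n) := ⟨⟨0, hn ▸ finrank_pos⟩⟩
  exact Finset.sum_pos (fun j _ => mul_pos (ht j) (hv j τ)) Finset.univ_nonempty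

/-- The integrand `N(t)^(k-1) exp(-⟨t, x⟩)`. -/
def kernel (k : ℕ) (x : F) (t : (F →+* ℝ) → ℝ) : ℝ≥0∞ :=
  ENNReal.ofReal ((∏ τ, t τ) ^ (k - 1) * Real.exp (-pair t x))

theorem measurable_kernel (k : ℕ) (x : F) : Measurable (kernel k x) := by
  refine ENNReal.measurable_ofReal.comp (Continuous.measurable ?_)
  exact ((continuous_finsetProd _ fun τ _ => continuous_apply τ).pow _).mul
    (Real.continuous_exp.comp (continuous_pair x).neg)

theorem lintegral_kernel_orthant (hn : finrank ℚ F = n) {k : ℕ} (hk : 1 ≤ k) {x : F}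
    (hx : ∀ τ : F →+* ℝ, 0 < τ x) :
    ∫⁻ t in orthant F, kernel k x t =
      ENNReal.ofReal (((k - 1).factorial : ℝ) ^ n / ((Algebra.norm ℚ x : ℚ) : ℝ) ^ k) := by
  unfold kernel orthant
  have h1 (t : (F →+* ℝ) → ℝ) : (∏ τ, t τ) ^ (k - 1) * Real.exp (-pair t x) =
      ∏ τ, t τ ^ (k - 1) * Real.exp (-(τ x * t τ)) := by
    rw [Finset.prod_mul_distrib, Finset.prod_pow, ← Real.exp_sum, Finset.sum_neg_distrib, pair]
    simp only [mul_comm]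
  simp only [h1]
  rw [← ofReal_integral_eq_lintegral_ofReal (integrableOn_monomial hx fun _ => k - 1),
    integral_monomial hx fun _ => k - 1]
  · rw [Finset.prod_div_distrib, Finset.prod_const, Finset.card_univ, card_realEmb, hn,
      Finset.prod_pow, prod_realEmb, Nat.sub_add_cancel hk]
  · filter_upwards [ae_restrict_mem measurableSet_orthant] with t ht
    exact Finset.prod_nonneg fun τ _ => mul_nonneg (pow_nonneg (ht τ).le _) (Real.exp_pos _).le

/-- The norm form `∏ τ, ∑ j, τ(v_j) X_j` of a family of elements of `F`. -/
def normForm (v : Fin n → F) : MvPolynomial (Fin n) ℝ :=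
  ∏ τ : F →+* ℝ, ∑ j, MvPolynomial.C (τ (v j)) * MvPolynomial.X j

theorem eval_normForm (v : Fin n → F) (z : Fin n → ℝ) :
    MvPolynomial.eval z (normForm v) = ∏ τ : F →+* ℝ, ∑ j, z j * τ (v j) := by
  simp [normForm, mul_comm]

/-- Substitute `t = ∑ z_j v_j`: the norm becomes the norm form of `v`, and duality turns `⟨t, ∑ m_j
w_j⟩` into `∑ m_j z_j`. -/
theorem lintegral_kernel_dualRegion {a : FractionalIdeal (𝓞 F)⁰ F} (ha : IsIntBasis a w)
    (h : IsTraceDual w v) (hn : finrank ℚ F = n) (hv : ∀ j (τ : F →+* ℝ), 0 < τ (v j))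
    (k : ℕ) {m : Fin n → ℤ} (hm : ∀ j, 0 < m j) :
    ∫⁻ t in dualRegion w, kernel k (∑ j, (m j : F) * w j) t =
      ENNReal.ofReal (1 / (√(discr F : ℝ) * ((FractionalIdeal.absNorm a : ℚ) : ℝ))) *
        ENNReal.ofReal (∑ l ∈ (normForm v ^ (k - 1)).support, (normForm v ^ (k - 1)).coeff l *
        ∏ j, ((l j).factorial : ℝ) / (m j : ℝ) ^ (l j + 1)) := by
  have e : Fin n ≃ (F →+* ℝ) := (Fintype.equivFinOfCardEq ((card_realEmb F).trans hn)).symm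
  have hdet := ha.abs_det_dual h hn e
  have hdet0 : (Matrix.of fun i j => e i (v j)).det ≠ 0 := by
    intro h0
    have := abs_det_mul_abs_det_dual e h
    simp [h0] at this
  rw [dualRegion_eq_image h hn, lintegral_linear_change e (fun τ j => τ (v j)) hdet0 _
    measurableSet_orthant, hdet, ← lintegral_polynomial]
  · congr 2
    ext z
    rw [kernel, map_pow, eval_normForm, pair_sum]
    congr 4
    refine Finset.sum_congr rfl fun j _ => ?_
    have := pair_ratCast_mul (fun τ => ∑ j, z j * τ (v j)) (m j : ℚ) (w j)
    rw [h.pair_combination] at this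
    simpa using this
  · intro z hz
    rw [map_pow, eval_normForm]
    exact pow_nonneg (Finset.prod_nonneg fun τ _ => Finset.sum_nonneg fun j _ =>
      mul_nonneg (hz j).le (hv j τ).le) _
  · exact_mod_cast hm

end FieldIntegrals

/-! ### Rationality and positivity of the cones, convergence, and the value of one cone. -/

section Cones

theorem coneOf_reindex {ι κ : Type*} [Fintype ι] [Fintype κ] (e : ι ≃ κ) {n : ℕ}
    (α : κ → Fin n → ℝ) : coneOf (α ∘ e) = coneOf α := by
  ext x
  constructor
  · rintro ⟨c, hc, rfl⟩
    exact ⟨c ∘ e.symm, fun i => hc _, by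
      rw [← e.sum_comp fun i => (c ∘ e.symm) i • α i]; simp⟩
  · rintro ⟨c, hc, rfl⟩
    exact ⟨c ∘ e, fun i => hc _, by rw [← e.sum_comp fun i => c i • α i]; rfl⟩

variable {F : Type*} [Field F] [NumberField F] [IsTotallyReal F] {n : ℕ} {w v : Fin n → F}

theorem compositum_isAlgebraic {x : ℝ} (hx : x ∈ compositum F) : IsAlgebraic ℚ x := by
  have hle : compositum F ≤ (algebraicClosure ℚ ℝ).toSubfield := by
    refine iSup_le fun τ => ?_
    rintro _ ⟨y, rfl⟩
    refine (mem_algebraicClosure_iff).mpr ?_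
    have hy : IsAlgebraic ℚ y := Algebra.IsAlgebraic.isAlgebraic y
    exact hy.algHom τ.toRatAlgHom
  exact mem_algebraicClosure_iff.mp (hle hx)

theorem isAlgebraicCone_of_compositum {C : Set (Fin n → ℝ)}
    (h : IsRationalCone (compositum F) C) : IsAlgebraicCone C :=
  ⟨compositum F, fun _ hx => compositum_isAlgebraic hx, h⟩

theorem embVec_mem_compositum (v : Fin n → F) (τ : F →+* ℝ) (i : Fin n) :
    embVec v τ i ∈ compositum F :=
  (le_iSup (fun τ : F →+* ℝ => τ.fieldRange) τ) ⟨v i, rfl⟩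

/-- The vectors `τ(v)` and `τ(w)` form dual bases of `ℝ^n`, so positivity against all `τ(w)` means
positive coordinates along the `τ(v)`. -/
theorem posCone_eq_coneOf (h : IsTraceDual w v) (hn : finrank ℚ F = n) :
    posCone w = coneOf (embVec v) := by
  classical
  ext x
  constructor
  · intro hx
    refine ⟨fun τ => ∑ i, x i * τ (w i), hx, ?_⟩
    ext j
    simp only [Finset.sum_apply, Pi.smul_apply, smul_eq_mul, embVec, Finset.sum_mul]
    rw [Finset.sum_comm]
    have (i : Fin n) : ∑ τ : F →+* ℝ, x i * τ (w i) * τ (v j) =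
        x i * ∑ τ : F →+* ℝ, τ (w i) * τ (v j) := by
      rw [Finset.mul_sum]
      exact Finset.sum_congr rfl fun _ _ => by ring
    simp [this, h.sum_embeddings]
  · rintro ⟨s, hs, rfl⟩ σ
    have : ∑ i, (∑ τ, s τ • embVec v τ) i * σ (w i) = s σ := by
      simp only [Finset.sum_apply, Pi.smul_apply, smul_eq_mul, embVec, Finset.sum_mul]
      rw [Finset.sum_comm]
      have (τ : F →+* ℝ) : ∑ i, s τ * τ (v i) * σ (w i) = s τ * ∑ i, τ (v i) * σ (w i) := by
        rw [Finset.mul_sum]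
        exact Finset.sum_congr rfl fun _ _ => by ring
      simp [this, h.sum_index hn]
    rw [this]
    exact hs σ

theorem isRationalCone_posCone (h : IsTraceDual w v) (hn : finrank ℚ F = n) :
    IsRationalCone (compositum F) (posCone w) := by
  have e : Fin n ≃ (F →+* ℝ) := (Fintype.equivFinOfCardEq ((card_realEmb F).trans hn)).symm
  refine ⟨n, embVec v ∘ e, fun i h0 => ?_, fun i j => embVec_mem_compositum v _ _, ?_⟩
  · have hv0 (j : Fin n) : v j = 0 := by
      have : embVec v (e i) j = 0 := congrFun h0 j
      exact (map_eq_zero (e i)).mp this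
    have := h ⟨0, hn ▸ finrank_pos⟩ ⟨0, hn ▸ finrank_pos⟩
    simp [hv0] at this
  · rw [coneOf_reindex, posCone_eq_coneOf h hn]

theorem isTotallyPositive_posCone (h : IsTraceDual w v) (hn : finrank ℚ F = n)
    (hv : ∀ j (τ : F →+* ℝ), 0 < τ (v j)) : IsTotallyPositive (posCone w) := by
  rw [posCone_eq_coneOf h hn]
  rintro _ ⟨s, hs, rfl⟩ j
  simp only [Finset.sum_apply, Pi.smul_apply, smul_eq_mul]
  exact Finset.sum_pos (fun τ _ => mul_pos (hs τ) (hv j τ)) Finset.univ_nonempty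

/-- The generators `τ(v)` have strictly positive entries, so the cone stays away from the coordinate
hyperplanes. The constant is the smallest entry divided by the largest. -/
theorem exists_norm_le_of_mem_posCone (h : IsTraceDual w v) (hn : finrank ℚ F = n)
    (hv : ∀ j (τ : F →+* ℝ), 0 < τ (v j)) :
    ∃ c : ℝ, 0 < c ∧ ∀ x ∈ posCone w, ∀ j, c * ‖x‖ ≤ x j := by
  have : Nonempty (Fin n) := ⟨⟨0, hn ▸ finrank_pos⟩⟩
  obtain ⟨p, hp⟩ := Finite.exists_min fun p : Fin n × (F →+* ℝ) => p.2 (v p.1)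
  obtain ⟨q, hq⟩ := Finite.exists_max fun p : Fin n × (F →+* ℝ) => p.2 (v p.1)
  have hp0 := hv p.1 p.2
  have hq0 := hv q.1 q.2
  refine ⟨p.2 (v p.1) / q.2 (v q.1), div_pos hp0 hq0, fun x hx j => ?_⟩
  have hpos := isTotallyPositive_posCone h hn hv x hx
  rw [posCone_eq_coneOf h hn] at hx
  obtain ⟨s, hs, rfl⟩ := hx
  have hle (i : Fin n) : (∑ τ, s τ • embVec v τ) i ≤ q.2 (v q.1) * ∑ τ, s τ := by
    simp only [Finset.sum_apply, Pi.smul_apply, smul_eq_mul, Finset.mul_sum]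
    exact Finset.sum_le_sum fun τ _ => by
      rw [mul_comm]; exact mul_le_mul_of_nonneg_right (hq (i, τ)) (hs τ).le
  have hge : p.2 (v p.1) * ∑ τ, s τ ≤ (∑ τ, s τ • embVec v τ) j := by
    simp only [Finset.sum_apply, Pi.smul_apply, smul_eq_mul, Finset.mul_sum]
    exact Finset.sum_le_sum fun τ _ => by
      rw [mul_comm (s τ)]; exact mul_le_mul_of_nonneg_right (hp (j, τ)) (hs τ).le
  have hnorm : ‖∑ τ, s τ • embVec v τ‖ ≤ q.2 (v q.1) * ∑ τ, s τ := by
    refine (pi_norm_le_iff_of_nonempty _).mpr fun i => ?_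
    rw [Real.norm_of_nonneg (hpos i).le]
    exact hle i
  refine le_trans ?_ hge
  calc p.2 (v p.1) / q.2 (v q.1) * ‖∑ τ, s τ • embVec v τ‖
      ≤ p.2 (v p.1) / q.2 (v q.1) * (q.2 (v q.1) * ∑ τ, s τ) := by gcongr
    _ = p.2 (v p.1) * ∑ τ, s τ := by field_simp

theorem summable_inv_norm_pow {L : ℕ} (hL : n < L) :
    Summable fun x : Fin n → ℤ => (‖(fun i => (x i : ℝ))‖ ^ L)⁻¹ := by
  let Λ : Submodule ℤ (Fin n → ℝ) := Submodule.span ℤ (range (Pi.basisFun ℝ (Fin n)))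
  have hrank : finrank ℤ Λ = n := by
    rw [ZLattice.rank ℝ Λ]; simp
  have hs := ZLattice.summable_norm_pow_inv (L := Λ) L (by rw [hrank]; exact hL)
  have hmem (x : Fin n → ℤ) : (fun i => (x i : ℝ)) ∈ Λ := by
    rw [(Pi.basisFun ℝ (Fin n)).mem_span_iff_repr_mem ℤ]
    intro i
    exact ⟨x i, by simp⟩
  have hinj : Function.Injective fun x : Fin n → ℤ => (⟨fun i => (x i : ℝ), hmem x⟩ : Λ) := by
    intro x y hxy
    ext i
    exact Int.cast_injective (congrFun (congrArg Subtype.val hxy) i)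
  refine (hs.comp_injective hinj).congr fun x => ?_
  rw [Function.comp_apply, inv_pow]
  rfl

/-- Every coordinate is at least `c‖x‖`, so the term is bounded by `(c‖x‖)^(-|l|)`, which is
summable over `ℤ^n` as soon as `|l| > n`. -/
theorem summable_conicalTerm (h : IsTraceDual w v) (hn : finrank ℚ F = n)
    (hv : ∀ j (τ : F →+* ℝ), 0 < τ (v j)) {l : Fin n → ℕ} (hl : n < ∑ j, l j) :
    Summable (conicalTerm (posCone w) l) := by
  obtain ⟨c, hc, hx⟩ := exists_norm_le_of_mem_posCone h hn hv
  have hs := (((summable_inv_norm_pow hl).comp_injective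
    (Subtype.val_injective : Function.Injective
      (Subtype.val : IntPoints (posCone w) → Fin n → ℤ))).mul_left (c ^ (∑ j, l j))⁻¹)
  refine Summable.of_nonneg_of_le (fun x => ?_) (fun x => ?_) hs
  · have hpos := isTotallyPositive_posCone h hn hv _ x.2
    exact one_div_nonneg.mpr (Finset.prod_nonneg fun j _ => pow_nonneg (hpos j).le _)
  · have hpos := isTotallyPositive_posCone h hn hv _ x.2
    have : Nonempty (Fin n) := ⟨⟨0, hn ▸ finrank_pos⟩⟩
    have hnorm : 0 < ‖(fun i => (x.1 i : ℝ))‖ := by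
      rw [norm_pos_iff]
      intro h0
      have h1 := hpos (Classical.arbitrary _)
      have h2 := congrFun h0 (Classical.arbitrary _)
      simp only [Pi.zero_apply] at h2
      exact h1.ne' h2
    rw [conicalTerm, one_div, Function.comp_apply, ← mul_inv, ← mul_pow,
      ← Finset.prod_pow_eq_pow_sum]
    refine inv_anti₀ (Finset.prod_pos fun j _ => by positivity) ?_
    exact Finset.prod_le_prod (fun j _ => by positivity) fun j _ =>
      pow_le_pow_left₀ (by positivity) (hx _ x.2 j) _

variable {a : FractionalIdeal (𝓞 F)⁰ F}

/-- The totally positive elements of `𝔞` in the coordinates given by an integral basis. -/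
def intPointsEquiv (ha : IsIntBasis a w) : IntPoints (posCone w) ≃ totPosPart a :=
  Equiv.ofBijective
    (fun m => ⟨∑ j, (m.1 j : F) * w j, (ha.2 _).mpr (Submodule.sum_mem _ fun j _ => by
        rw [← zsmul_eq_mul]
        exact Submodule.smul_mem _ _ (Submodule.subset_span ⟨j, rfl⟩)),
      fun τ => by simpa using m.2 τ⟩)
    (by
      constructor
      · intro m m' hmm
        have h1 : ∑ j, (m.1 j) • w j = ∑ j, (m'.1 j) • w j := by
          simpa [zsmul_eq_mul] using congrArg Subtype.val hmm
        exact Subtype.ext (funext (Fintype.linearIndependent_iffₛ.mp ha.1 _ _ h1))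
      · rintro ⟨x, hxa, hx⟩
        obtain ⟨m, hm⟩ := (Submodule.mem_span_range_iff_exists_fun ℤ).mp ((ha.2 _).mp hxa)
        refine ⟨⟨m, fun τ => ?_⟩, Subtype.ext ?_⟩
        · have := hx τ
          rw [← hm] at this
          simpa [zsmul_eq_mul] using this
        · simpa [zsmul_eq_mul] using hm)

theorem coe_intPointsEquiv (ha : IsIntBasis a w) (m : IntPoints (posCone w)) :
    (intPointsEquiv ha m : F) = ∑ j, (m.1 j : F) * w j := rfl

/-- The determinant of multiplication by the generic element `∑ X_j v_j` is a rational polynomial.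
It agrees with the norm form at all rational points, hence identically, since `ℚ` is infinite. -/
theorem exists_rational_normForm (v : Fin n → F) :
    ∃ p : MvPolynomial (Fin n) ℚ, p.map (Rat.castHom ℝ) = normForm v := by
  classical
  let b := Module.finBasis ℚ F
  let p : MvPolynomial (Fin n) ℚ := Matrix.det (∑ j, (MvPolynomial.X j : MvPolynomial (Fin n) ℚ) •
    (Algebra.leftMulMatrix b (v j)).map (MvPolynomial.C : ℚ →+* MvPolynomial (Fin n) ℚ))
  have hp (q : Fin n → ℚ) : MvPolynomial.eval q p = Algebra.norm ℚ (∑ j, (q j : F) * v j) := by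
    rw [Algebra.norm_eq_matrix_det b, RingHom.map_det]
    congr 1
    ext r s
    simp only [RingHom.mapMatrix_apply, Matrix.map_apply, Matrix.sum_apply, Matrix.smul_apply,
      map_sum, smul_eq_mul, map_mul, MvPolynomial.eval_X, MvPolynomial.eval_C]
    refine Finset.sum_congr rfl fun j _ => ?_
    have : Algebra.leftMulMatrix b ((q j : F) * v j) = q j • Algebra.leftMulMatrix b (v j) := by
      rw [← map_smul, Algebra.smul_def]; simp
    rw [← map_mul, this, Matrix.smul_apply, smul_eq_mul]
  refine ⟨p, MvPolynomial.funext_set (fun _ => range (Rat.cast : ℚ → ℝ))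
    (fun _ => infinite_range_of_injective Rat.cast_injective) fun z hz => ?_⟩
  choose q hq using fun i => hz i (mem_univ i)
  obtain rfl : (fun i => (q i : ℝ)) = z := funext hq
  have h1 : MvPolynomial.eval (fun i => (q i : ℝ)) (p.map (Rat.castHom ℝ)) =
      ((MvPolynomial.eval q p : ℚ) : ℝ) := by
    rw [MvPolynomial.eval_map]
    exact (MvPolynomial.eval₂_comp_left (Rat.castHom ℝ) (RingHom.id ℚ) q p).symm ▸ rfl
  rw [h1, hp, eval_normForm, ← prod_realEmb]
  simp

theorem exists_rat_coeff_normForm_pow (v : Fin n → F) (k : ℕ) (m : Fin n →₀ ℕ) :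
    ∃ c : ℚ, (normForm v ^ k).coeff m = (c : ℝ) := by
  obtain ⟨p, hp⟩ := exists_rational_normForm v
  refine ⟨(p ^ k).coeff m, ?_⟩
  rw [← hp, ← map_pow, MvPolynomial.coeff_map]
  rfl

theorem isHomogeneous_normForm (hn : finrank ℚ F = n) (v : Fin n → F) :
    (normForm v).IsHomogeneous n := by
  have := MvPolynomial.IsHomogeneous.prod (Finset.univ : Finset (F →+* ℝ))
    (fun τ => ∑ j, MvPolynomial.C (τ (v j)) * MvPolynomial.X (R := ℝ) j) (fun _ => 1)
    (fun τ _ => MvPolynomial.IsHomogeneous.sum _ _ _ fun j _ => by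
      simpa using (MvPolynomial.isHomogeneous_C (Fin n) (τ (v j))).mul
        (MvPolynomial.isHomogeneous_X ℝ j))
  simp only [Finset.sum_const, Finset.card_univ, card_realEmb, hn, smul_eq_mul, mul_one] at this
  exact this

/-- Polynomials with nonnegative coefficients form a subsemiring containing the linear factors. This
makes every summand of `coneValue` nonnegative, as the passage through `ℝ≥0∞` requires. -/
theorem coeff_normForm_pow_nonneg (hv : ∀ j (τ : F →+* ℝ), 0 < τ (v j)) (k : ℕ)
    (m : Fin n →₀ ℕ) : 0 ≤ (normForm v ^ k).coeff m := by
  classical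
  let S : Subsemiring (MvPolynomial (Fin n) ℝ) :=
    { carrier := {p | ∀ m, 0 ≤ p.coeff m}
      mul_mem' := fun {p q} hp hq m => by
        rw [MvPolynomial.coeff_mul]
        exact Finset.sum_nonneg fun _ _ => mul_nonneg (hp _) (hq _)
      one_mem' := fun m => by
        rw [MvPolynomial.coeff_one]; split_ifs <;> norm_num
      add_mem' := fun {p q} hp hq m => by
        rw [MvPolynomial.coeff_add]; exact add_nonneg (hp m) (hq m)
      zero_mem' := fun m => by simp }
  have : normForm v ∈ S := Subsemiring.prod_mem _ fun τ _ => Subsemiring.sum_mem _ fun j _ m => by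
    rw [MvPolynomial.coeff_C_mul, MvPolynomial.coeff_X]
    have := (hv j τ).le
    split_ifs <;> simp [this]
  exact pow_mem this k m

/-- By homogeneity only exponents of total degree `n * k` occur, so the sum can be taken over an
index set independent of `v`. -/
theorem sum_support_normForm_pow (hn : finrank ℚ F = n) (v : Fin n → F) (k : ℕ)
    (f : (Fin n → ℕ) → ℝ) :
    ∑ l ∈ (normForm v ^ k).support, (normForm v ^ k).coeff l * f l =
      ∑ l ∈ Finset.piAntidiag (Finset.univ : Finset (Fin n)) (n * k),
        (normForm v ^ k).coeff (Finsupp.equivFunOnFinite.symm l) * f l := by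
  have hsub : (normForm v ^ k).support ⊆
      (Finset.piAntidiag (Finset.univ : Finset (Fin n)) (n * k)).map
        Finsupp.equivFunOnFinite.symm.toEmbedding := by
    intro m hm
    refine Finset.mem_map.mpr ⟨m, ?_, Finsupp.equivFunOnFinite.symm_apply_apply m⟩
    have := ((isHomogeneous_normForm hn v).pow k) (MvPolynomial.mem_support_iff.mp hm)
    rw [Finset.mem_piAntidiag]
    refine ⟨?_, by simp⟩
    rw [← this, Finsupp.weight_apply, Finsupp.sum_fintype] <;> simp
  rw [Finset.sum_subset hsub fun l _ hl => by
    rw [MvPolynomial.notMem_support_iff.mp hl, zero_mul], Finset.sum_map]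
  rfl

/-- The contribution `∑ l, l! c_l ζ_C(l + 1)` of one cone to the partial zeta value. -/
def coneValue (w v : Fin n → F) (k : ℕ) : ℝ :=
  ∑ l ∈ Finset.piAntidiag (Finset.univ : Finset (Fin n)) (n * (k - 1)),
    (∏ j, ((l j).factorial : ℝ)) *
      (normForm v ^ (k - 1)).coeff (Finsupp.equivFunOnFinite.symm l) *
        conicalZeta (posCone w) (fun j => l j + 1)

theorem conicalTerm_nonneg {C : Set (Fin n → ℝ)} (hC : IsTotallyPositive C) (l : Fin n → ℕ)
    (x : IntPoints C) : 0 ≤ conicalTerm C l x :=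
  one_div_nonneg.mpr (Finset.prod_nonneg fun j _ => pow_nonneg (hC _ x.2 j).le _)

theorem coneValue_nonneg (h : IsTraceDual w v) (hn : finrank ℚ F = n)
    (hv : ∀ j (τ : F →+* ℝ), 0 < τ (v j)) (k : ℕ) : 0 ≤ coneValue w v k :=
  Finset.sum_nonneg fun l _ => mul_nonneg (mul_nonneg (by positivity)
    (coeff_normForm_pow_nonneg hv _ _))
    (tsum_nonneg (conicalTerm_nonneg (isTotallyPositive_posCone h hn hv) _))

/-- Summing the one-cone integral over `𝔞₊`, parametrised by the integral points of `posCone w`,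
turns each monomial into a conical zeta value. -/
theorem tsum_lintegral_kernel_dualRegion (ha : IsIntBasis a w)
    (h : IsTraceDual w v) (hn : finrank ℚ F = n) (hv : ∀ j (τ : F →+* ℝ), 0 < τ (v j))
    {k : ℕ} (hk : 2 ≤ k) :
    ∑' x : totPosPart a, ∫⁻ t in dualRegion w, kernel k (x : F) t =
      ENNReal.ofReal (1 / (√(discr F : ℝ) * ((FractionalIdeal.absNorm a : ℚ) : ℝ))) *
        ENNReal.ofReal (coneValue w v k) := by
  have hpos := isTotallyPositive_posCone h hn hv
  have hn0 : 0 < n := hn ▸ finrank_pos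
  have hsum (l) (hl : l ∈ Finset.piAntidiag (Finset.univ : Finset (Fin n)) (n * (k - 1))) :
      Summable (conicalTerm (posCone w) fun j => l j + 1) := by
    refine summable_conicalTerm h hn hv ?_
    rw [Finset.mem_piAntidiag] at hl
    rw [Finset.sum_add_distrib, hl.1]
    -- The hypothesis `2 ≤ k` is needed here: for `k = 1` the exponents would sum to exactly `n`.
    have : 0 < n * (k - 1) := Nat.mul_pos hn0 (by omega)
    simp only [Finset.sum_const, Finset.card_univ, Fintype.card_fin, smul_eq_mul]
    omega
  rw [← (intPointsEquiv ha).tsum_eq]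
  have hterm (m : IntPoints (posCone w)) :
      ∫⁻ t in dualRegion w, kernel k (intPointsEquiv ha m : F) t =
      ENNReal.ofReal (1 / (√(discr F : ℝ) * ((FractionalIdeal.absNorm a : ℚ) : ℝ))) *
        ENNReal.ofReal (∑ l ∈ Finset.piAntidiag (Finset.univ : Finset (Fin n)) (n * (k - 1)),
          (∏ j, ((l j).factorial : ℝ)) *
          (normForm v ^ (k - 1)).coeff (Finsupp.equivFunOnFinite.symm l) *
          conicalTerm (posCone w) (fun j => l j + 1) m) := by
    rw [coe_intPointsEquiv, lintegral_kernel_dualRegion ha h hn hv k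
      fun j => by exact_mod_cast hpos _ m.2 j]
    have := sum_support_normForm_pow hn v (k - 1)
      fun l => ∏ j, ((l j).factorial : ℝ) / (m.1 j : ℝ) ^ (l j + 1)
    rw [this]
    congr 2
    refine Finset.sum_congr rfl fun l _ => ?_
    rw [conicalTerm, Finset.prod_div_distrib]
    ring
  simp only [hterm]
  rw [ENNReal.tsum_mul_left, ← ENNReal.ofReal_tsum_of_nonneg]
  · congr 2
    rw [Summable.tsum_finsetSum fun l hl => (hsum l hl).mul_left _]
    exact Finset.sum_congr rfl fun l _ => by rw [tsum_mul_left]; rfl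
  · exact fun m => Finset.sum_nonneg fun l _ => mul_nonneg (mul_nonneg (by positivity)
      (coeff_normForm_pow_nonneg hv _ _)) (conicalTerm_nonneg hpos _ _)
  · exact summable_sum fun l hl => (hsum l hl).mul_left _

end Cones

/-! ### Unfolding the sum over the unit group. -/

section Unfolding

variable {F : Type*} [Field F] [NumberField F] [IsTotallyReal F] {n : ℕ} {w v : Fin n → F}

/-- A point of `ℝ ⊗ F` which lies on no hyperplane `⟨t, c⟩ = 0` with `c ∈ F` nonzero. -/
def IsGeneric (t : (F →+* ℝ) → ℝ) : Prop := ∀ c : F, c ≠ 0 → pair t c ≠ 0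

variable (F) in
theorem countable_numberField : Countable F :=
  (Module.finBasis ℚ F).equivFun.injective.countable

-- `F` is countable and each `⟨t, c⟩ = 0` with `c ≠ 0` is a proper hyperplane, so the exceptional
-- set is a countable union of null sets.
variable (F) in
theorem ae_isGeneric : ∀ᵐ t : (F →+* ℝ) → ℝ, IsGeneric t := by
  classical
  have := countable_numberField F
  unfold IsGeneric
  rw [ae_all_iff]
  intro c
  by_cases hc : c = 0
  · simp [hc]
  have hnull : volume ((LinearMap.ker (∑ τ : F →+* ℝ, τ c • LinearMap.proj (R := ℝ)
      (φ := fun _ : F →+* ℝ => ℝ) τ) : Submodule ℝ ((F →+* ℝ) → ℝ)) : Set ((F →+* ℝ) → ℝ)) = 0 := by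
    refine Measure.addHaar_submodule volume _ fun htop => ?_
    obtain ⟨σ⟩ : Nonempty (F →+* ℝ) := inferInstance
    have : Pi.single σ (1 : ℝ) ∈ (⊤ : Submodule ℝ ((F →+* ℝ) → ℝ)) := trivial
    rw [← htop, LinearMap.mem_ker] at this
    simp [Pi.single_apply, hc] at this
  filter_upwards [measure_eq_zero_iff_ae_notMem.mp hnull] with t ht _ h0
  refine ht ?_
  rw [SetLike.mem_coe, LinearMap.mem_ker, ← h0]
  simp [pair, mul_comm]

/-- A totally positive unit as an element of the field. -/
def unitVal (u : totPosUnits F) : F := ((u.1 : 𝓞 F) : F)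

theorem unitVal_pos (u : totPosUnits F) (τ : F →+* ℝ) : 0 < τ (unitVal u) := u.2 τ

theorem unitVal_ne_zero (u : totPosUnits F) : unitVal u ≠ 0 := by
  obtain ⟨σ⟩ : Nonempty (F →+* ℝ) := inferInstance
  intro h0
  have := unitVal_pos u σ
  simp [h0] at this

theorem unitVal_mul (u u' : totPosUnits F) : unitVal (u * u') = unitVal u * unitVal u' := by
  simp [unitVal]

theorem unitVal_one : unitVal (1 : totPosUnits F) = 1 := by
  simp [unitVal]

theorem unitVal_inv (u : totPosUnits F) : unitVal u⁻¹ = (unitVal u)⁻¹ := by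
  refine eq_inv_of_mul_eq_one_left ?_
  rw [← unitVal_mul, inv_mul_cancel, unitVal_one]

theorem unitVal_injective : Function.Injective (unitVal (F := F)) := fun _ _ h =>
  Subtype.ext (Units.ext (RingOfIntegers.ext h))

instance : Countable (totPosUnits F) :=
  have := countable_numberField F
  unitVal_injective.countable

theorem prod_unitVal (u : totPosUnits F) : ∏ τ : F →+* ℝ, τ (unitVal u) = 1 := by
  rw [prod_realEmb, unitVal, norm_totPosUnit u.2, Rat.cast_one]

theorem pair_mul_left (t : (F →+* ℝ) → ℝ) (c d : F) :
    pair (fun τ => t τ * τ c) d = pair t (c * d) := by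
  simp [pair, mul_assoc]

/-- Substitute `t ↦ t · u`. As `u` has norm one, both the Jacobian and `N(t)` are unaffected, and
only the exponent changes. -/
theorem lintegral_kernel_unit (u : totPosUnits F) (w : Fin n → F) (k : ℕ) (x : F) :
    ∫⁻ t in dualRegion fun j => unitVal u * w j, kernel k x t =
      ∫⁻ t in dualRegion w, kernel k ((unitVal u)⁻¹ * x) t := by
  classical
  have hsum (z : (F →+* ℝ) → ℝ) :
      (fun τ => ∑ σ, z σ * (if τ = σ then τ (unitVal u) else 0)) =
        fun τ => z τ * τ (unitVal u) := by
    ext τ; simp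
  have himage : (fun z τ => ∑ σ, z σ * (if τ = σ then τ (unitVal u) else 0)) ''
      (dualRegion fun j => unitVal u * w j) = dualRegion w := by
    ext t
    constructor
    · rintro ⟨z, hz, rfl⟩ j
      simp only [hsum, pair_mul_left]
      exact hz j
    · intro ht
      have h1 : (fun τ => (t τ * τ (unitVal u)⁻¹) * τ (unitVal u)) = t := by
        ext τ
        rw [mul_assoc, ← map_mul, inv_mul_cancel₀ (unitVal_ne_zero u), map_one, mul_one]
      refine ⟨fun τ => t τ * τ (unitVal u)⁻¹, fun j => ?_, ?_⟩
      · rw [← pair_mul_left, h1]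
        exact ht j
      · exact (hsum _).trans h1
  have hdet : (Matrix.of fun τ σ : F →+* ℝ =>
      if Equiv.refl _ τ = σ then Equiv.refl _ τ (unitVal u) else (0 : ℝ)).det = 1 := by
    have : (Matrix.of fun τ σ : F →+* ℝ =>
        if Equiv.refl _ τ = σ then Equiv.refl _ τ (unitVal u) else (0 : ℝ)) =
        Matrix.diagonal fun τ : F →+* ℝ => τ (unitVal u) := by
      ext τ σ
      simp only [Matrix.of_apply, Equiv.refl_apply, Matrix.diagonal_apply]
      exact ite_congr rfl (fun _ => rfl) fun _ => rfl
    rw [this, Matrix.det_diagonal, prod_unitVal]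
  rw [← himage, lintegral_linear_change (Equiv.refl _)
    (fun τ σ : F →+* ℝ => if τ = σ then τ (unitVal u) else 0) (by rw [hdet]; exact one_ne_zero) _
    (measurableSet_dualRegion _), hdet]
  simp only [hsum, abs_one, ENNReal.ofReal_one, one_mul]
  congr 1
  ext z
  unfold kernel
  rw [pair_mul_left, ← mul_assoc, mul_inv_cancel₀ (unitVal_ne_zero u), one_mul,
    Finset.prod_mul_distrib, prod_unitVal, mul_one]

variable {a : FractionalIdeal (𝓞 F)⁰ F}

theorem unitVal_inv_mul_mem (u : totPosUnits F) (x : totPosPart a) :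
    (unitVal u)⁻¹ * (x : F) ∈ totPosPart a := by
  refine ⟨?_, fun τ => ?_⟩
  · rw [← unitVal_inv]
    have := (a : Submodule (𝓞 F) F).smul_mem ((u⁻¹).1 : 𝓞 F) x.2.1
    rwa [Algebra.smul_def] at this
  · rw [map_mul, map_inv₀]
    exact mul_pos (inv_pos.mpr (unitVal_pos u τ)) (x.2.2 τ)

/-- The unit group acts freely on `𝔞₊`: a decomposition of `𝔞₊` into orbits. -/
def orbitEquiv (a : FractionalIdeal (𝓞 F)⁰ F) :
    Quotient (unitSetoid a) × totPosUnits F ≃ totPosPart a :=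
  Equiv.ofBijective (fun p => ⟨(unitVal p.2)⁻¹ * (p.1.out : F), unitVal_inv_mul_mem _ _⟩)
    (by
      constructor
      · rintro ⟨q, u⟩ ⟨q', u'⟩ h
        have h' : (unitVal u)⁻¹ * (q.out : F) = (unitVal u')⁻¹ * (q'.out : F) :=
          congrArg Subtype.val h
        have hu := unitVal_ne_zero u
        have hu' := unitVal_ne_zero u'
        have hq : q = q' := by
          rw [← Quotient.out_eq q, ← Quotient.out_eq q']
          refine Quotient.sound ⟨(u' * u⁻¹).1, (u' * u⁻¹).2, ?_⟩
          change (q'.out : F) = unitVal (u' * u⁻¹) * q.out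
          rw [unitVal_mul, unitVal_inv, mul_assoc, h', ← mul_assoc, mul_inv_cancel₀ hu', one_mul]
        subst hq
        have hx : (q.out : F) ≠ 0 := by
          obtain ⟨σ⟩ : Nonempty (F →+* ℝ) := inferInstance
          intro h0
          have := q.out.2.2 σ
          simp [h0] at this
        have := inv_injective (mul_right_cancel₀ hx h')
        rw [unitVal_injective this]
      · intro x
        have hx : (unitSetoid a).r (Quotient.mk (unitSetoid a) x).out x :=
          Quotient.mk_out (s := unitSetoid a) x
        obtain ⟨u, hu, h⟩ := hx
        refine ⟨⟨Quotient.mk (unitSetoid a) x, ⟨u, hu⟩⁻¹⟩, Subtype.ext ?_⟩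
        change (unitVal (⟨u, hu⟩⁻¹ : totPosUnits F))⁻¹ * _ = _
        rw [unitVal_inv, inv_inv, h]
        rfl)

/-- A finite family of cones with multiplicities, whose translates by the totally positive units
cover almost every point of the totally positive orthant with total weight `1`. -/
def IsUnitPartition {S : Type*} [Fintype S] (W : S → Fin n → F) (N : S → ℕ) : Prop :=
  ∀ t ∈ orthant F, IsGeneric t →
    ∑' u : totPosUnits F, ∑ s, ((N s : ℝ≥0∞))⁻¹ *
      (dualRegion fun j => unitVal u * W s j).indicator 1 t = 1

theorem dualRegion_unit_subset_orthant (h : IsTraceDual w v) (hn : finrank ℚ F = n)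
    (hv : ∀ j (τ : F →+* ℝ), 0 < τ (v j)) (u : totPosUnits F) :
    (dualRegion fun j => unitVal u * w j) ⊆ orthant F := by
  intro t ht τ
  have h1 : (fun τ => t τ * τ (unitVal u)) ∈ dualRegion w := fun j => by
    rw [pair_mul_left]; exact ht j
  have h2 := dualRegion_subset_orthant h hn hv h1 τ
  exact pos_of_mul_pos_left h2 (unitVal_pos u τ).le

/-- Cut the orthant along the weighted partition and move each translate back to its base cone. The
double sum over classes and units is then a single sum over `𝔞₊`, because the units act freely. -/
theorem tsum_lintegral_orthant {S : Type*} [Fintype S] {W V : S → Fin n → F} {N : S → ℕ}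
    (hW : ∀ s, IsTraceDual (W s) (V s)) (hn : finrank ℚ F = n)
    (hV : ∀ s j (τ : F →+* ℝ), 0 < τ (V s j)) (hpart : IsUnitPartition W N) (k : ℕ) :
    ∑' q : Quotient (unitSetoid a), ∫⁻ t in orthant F, kernel k (q.out : F) t =
      ∑ s, (N s : ℝ≥0∞)⁻¹ * ∑' x : totPosPart a, ∫⁻ t in dualRegion (W s), kernel k (x : F) t := by
  have hmeas (s : S) (u : totPosUnits F) :=
    measurableSet_dualRegion fun j => unitVal u * W s j
  have h1 (x : F) : ∫⁻ t in orthant F, kernel k x t = ∑' u : totPosUnits F, ∑ s,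
      (N s : ℝ≥0∞)⁻¹ * ∫⁻ t in dualRegion (W s), kernel k ((unitVal u)⁻¹ * x) t := by
    -- The weighted sum of indicators in `hpart` equals one at almost every point, so it can be
    -- inserted into the integrand.
    have h2 : ∫⁻ t in orthant F, kernel k x t = ∫⁻ t in orthant F, ∑' u : totPosUnits F, ∑ s,
        (N s : ℝ≥0∞)⁻¹ * (dualRegion fun j => unitVal u * W s j).indicator (kernel k x) t := by
      refine setLIntegral_congr_fun_ae measurableSet_orthant ?_
      filter_upwards [ae_isGeneric F] with t ht hto
      conv_lhs => rw [← one_mul (kernel k x t), ← hpart t hto ht, ← ENNReal.tsum_mul_right]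
      congr 1
      ext u
      rw [Finset.sum_mul]
      refine Finset.sum_congr rfl fun s _ => ?_
      rw [mul_assoc]
      congr 1
      by_cases hmem : t ∈ dualRegion fun j => unitVal u * W s j <;> simp [hmem]
    rw [h2, lintegral_tsum fun u => (Finset.measurable_fun_sum _ fun s _ =>
      ((measurable_kernel k x).indicator (hmeas s u)).const_mul _).aemeasurable]
    congr 1
    ext u
    rw [lintegral_finsetSum _ fun s _ =>
      ((measurable_kernel k x).indicator (hmeas s u)).const_mul _]
    refine Finset.sum_congr rfl fun s _ => ?_
    rw [lintegral_const_mul _ ((measurable_kernel k x).indicator (hmeas s u)),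
      lintegral_indicator (hmeas s u), Measure.restrict_restrict (hmeas s u),
      inter_eq_left.mpr (dualRegion_unit_subset_orthant (hW s) hn (hV s) u),
      lintegral_kernel_unit]
  simp only [h1]
  rw [← ENNReal.tsum_prod (f := fun (q : Quotient (unitSetoid a)) (u : totPosUnits F) => ∑ s,
    (N s : ℝ≥0∞)⁻¹ * ∫⁻ t in dualRegion (W s), kernel k ((unitVal u)⁻¹ * (q.out : F)) t)]
  rw [Summable.tsum_finsetSum fun _ _ => ENNReal.summable]
  refine Finset.sum_congr rfl fun s _ => ?_
  rw [ENNReal.tsum_mul_left, ← (orbitEquiv a).tsum_eq]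
  rfl

theorem partialZetaTerm_eq (k : ℕ) (q : Quotient (unitSetoid a)) :
    partialZetaTerm a (k : ℂ) q =
      ((1 / ((Algebra.norm ℚ (q.out : F) : ℚ) : ℝ) ^ k : ℝ) : ℂ) := by
  conv_lhs => rw [← Quotient.out_eq q]
  change 1 / ((Algebra.norm ℚ (q.out : F) : ℚ) : ℂ) ^ (k : ℂ) = _
  rw [Complex.cpow_natCast]
  push_cast
  rfl

/-- The formula for the partial zeta values attached to a weighted partition of the totally
positive orthant into unimodular cones and their translates. -/
theorem partialZeta_of_isUnitPartition {S : Type*} [Fintype S] {W V : S → Fin n → F} {N : S → ℕ}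
    (hN : ∀ s, N s ≠ 0) (hint : ∀ s, IsIntBasis a (W s))
    (hW : ∀ s, IsTraceDual (W s) (V s)) (hn : finrank ℚ F = n)
    (hV : ∀ s j (τ : F →+* ℝ), 0 < τ (V s j)) (hpart : IsUnitPartition W N) {k : ℕ} (hk : 2 ≤ k) :
    Summable (partialZetaTerm a (k : ℂ)) ∧
      partialZeta a (k : ℂ) =
        ((1 / ((((k - 1).factorial : ℝ) ^ n) * √(discr F : ℝ) *
          ((FractionalIdeal.absNorm a : ℚ) : ℝ)) *
            ∑ s, (N s : ℝ)⁻¹ * coneValue (W s) (V s) k : ℝ) : ℂ) := by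
  have hk1 : 1 ≤ k := by omega
  set D : ℝ := 1 / (√(discr F : ℝ) * ((FractionalIdeal.absNorm a : ℚ) : ℝ)) with hD
  have hD0 : 0 ≤ D := by
    have : (0 : ℝ) ≤ ((FractionalIdeal.absNorm a : ℚ) : ℝ) := by
      exact_mod_cast FractionalIdeal.absNorm_nonneg a
    positivity
  set R : Quotient (unitSetoid a) → ℝ := fun q =>
    1 / ((Algebra.norm ℚ (q.out : F) : ℚ) : ℝ) ^ k with hR
  have hnorm (q : Quotient (unitSetoid a)) : 0 < ((Algebra.norm ℚ (q.out : F) : ℚ) : ℝ) := by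
    exact_mod_cast norm_pos_of_totPos q.out.2.2
  have hfac : (0 : ℝ) < ((k - 1).factorial : ℝ) ^ n := by positivity
  have key : ∑' q, ENNReal.ofReal (((k - 1).factorial : ℝ) ^ n * R q) =
      ENNReal.ofReal (D * ∑ s, (N s : ℝ)⁻¹ * coneValue (W s) (V s) k) := by
    have h1 := tsum_lintegral_orthant (a := a) hW hn hV hpart k
    simp only [tsum_lintegral_kernel_dualRegion (hint _) (hW _) hn (hV _) hk] at h1
    have h2 (q : Quotient (unitSetoid a)) : ∫⁻ t in orthant F, kernel k (q.out : F) t =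
        ENNReal.ofReal (((k - 1).factorial : ℝ) ^ n * R q) := by
      rw [lintegral_kernel_orthant hn hk1 q.out.2.2, hR, mul_one_div]
    simp only [h2] at h1
    rw [h1, Finset.mul_sum, ENNReal.ofReal_sum_of_nonneg fun s _ => mul_nonneg hD0
      (mul_nonneg (by positivity) (coneValue_nonneg (hW s) hn (hV s) k))]
    refine Finset.sum_congr rfl fun s _ => ?_
    have hs : (0 : ℝ) < N s := by exact_mod_cast (hN s).bot_lt
    rw [ENNReal.ofReal_mul hD0, ENNReal.ofReal_mul (by positivity), ENNReal.ofReal_inv_of_pos hs,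
      ENNReal.ofReal_natCast]
    ring
  have hR0 (q) : 0 ≤ ((k - 1).factorial : ℝ) ^ n * R q :=
    mul_nonneg hfac.le (one_div_nonneg.mpr (pow_nonneg (hnorm q).le _))
  have hsum0 : 0 ≤ D * ∑ s, (N s : ℝ)⁻¹ * coneValue (W s) (V s) k :=
    mul_nonneg hD0 (Finset.sum_nonneg fun s _ => mul_nonneg (by positivity)
      (coneValue_nonneg (hW s) hn (hV s) k))
  have hfR : Summable fun q => ((k - 1).factorial : ℝ) ^ n * R q := by
    -- Summability comes from the identity itself: the right-hand side of `key` is finite.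
    have : ∑' q, ENNReal.ofReal (((k - 1).factorial : ℝ) ^ n * R q) ≠ ⊤ := by
      rw [key]; exact ENNReal.ofReal_ne_top
    have := ENNReal.summable_toReal this
    simpa only [ENNReal.toReal_ofReal (hR0 _)] using this
  have hRs : Summable R := (summable_mul_left_iff hfac.ne').mp hfR
  have hterm : partialZetaTerm a (k : ℂ) = fun q => ((R q : ℝ) : ℂ) :=
    funext fun q => partialZetaTerm_eq k q
  refine ⟨by rw [hterm]; exact_mod_cast hRs, ?_⟩
  rw [partialZeta, hterm, ← Complex.ofReal_tsum]
  congr 1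
  rw [← ENNReal.ofReal_tsum_of_nonneg hR0 hfR, tsum_mul_left,
    ENNReal.ofReal_eq_ofReal_iff (mul_nonneg hfac.le
      (tsum_nonneg fun q => one_div_nonneg.mpr (pow_nonneg (hnorm q).le _))) hsum0] at key
  rw [eq_div_of_mul_eq hfac.ne' ((mul_comm _ _).trans key), hD]
  simp only [one_div, mul_inv]
  ring

end Unfolding

/-! ### Subdivision of simplicial cones. -/

/-- A simplicial cone in `ℝ ⊗ F` with totally positive generators `v_j` in `F`, together with the
dual family `w` of linear forms. -/
structure PosSimplex (F : Type*) [Field F] [NumberField F] (n : ℕ) where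
  w : Fin n → F
  v : Fin n → F
  dual : IsTraceDual w v
  pos : ∀ j (τ : F →+* ℝ), 0 < τ (v j)

namespace PosSimplex

variable {F : Type*} [Field F] [NumberField F] [IsTotallyReal F] {n : ℕ}

/-- The indicator function of the open cone. -/
def ind (s : PosSimplex F n) (t : (F →+* ℝ) → ℝ) : ℕ := (dualRegion s.w).indicator 1 t

theorem ind_of_mem {s : PosSimplex F n} {t : (F →+* ℝ) → ℝ} (h : t ∈ dualRegion s.w) :
    s.ind t = 1 := by simp [ind, h]

theorem ind_of_notMem {s : PosSimplex F n} {t : (F →+* ℝ) → ℝ} (h : t ∉ dualRegion s.w) :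
    s.ind t = 0 := by simp [ind, h]

theorem ind_ne_zero {s : PosSimplex F n} {t : (F →+* ℝ) → ℝ} :
    s.ind t ≠ 0 ↔ t ∈ dualRegion s.w := by simp [ind]

theorem w_ne_zero (s : PosSimplex F n) (i : Fin n) : s.w i ≠ 0 := by
  intro h
  have := s.dual i i
  simp [h] at this

/-- Up to non-generic points, the cone is the disjoint union of finitely many cones with the
property `R`. -/
def Subdivides (R : PosSimplex F n → Prop) (s : PosSimplex F n) : Prop :=
  ∃ L : List (PosSimplex F n), (∀ s' ∈ L, R s') ∧
    ∀ t, IsGeneric t → s.ind t = (L.map fun s' => s'.ind t).sum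

theorem Subdivides.refl {R : PosSimplex F n → Prop} {s : PosSimplex F n} (h : R s) :
    Subdivides R s := ⟨[s], by simpa using h, by simp⟩

/-- Besides `R`, a piece may be assumed to lie inside `s` at generic points, since indicators are
nonnegative and sum to that of `s`. Properties inherited by subcones thus survive later
subdivisions. -/
theorem Subdivides.mono {R R' : PosSimplex F n → Prop} {s : PosSimplex F n}
    (h : Subdivides R s) (hR : ∀ s', R s' →
      (∀ t, IsGeneric t → t ∈ dualRegion s'.w → t ∈ dualRegion s.w) → R' s') :
    Subdivides R' s := by
  obtain ⟨L, hL, hsum⟩ := h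
  refine ⟨L, fun s' hs' => hR s' (hL s' hs') fun t ht hmem => ?_, hsum⟩
  rw [← ind_ne_zero, hsum t ht]
  intro h0
  have := List.sum_eq_zero_iff.mp h0 (s'.ind t) (List.mem_map.mpr ⟨s', hs', rfl⟩)
  exact ind_ne_zero.mpr hmem this

theorem Subdivides.bind {R R' : PosSimplex F n → Prop} {s : PosSimplex F n}
    (h : Subdivides R s) (hR : ∀ s', R s' → Subdivides R' s') : Subdivides R' s := by
  obtain ⟨L, hL, hsum⟩ := h
  have key : ∃ L' : List (PosSimplex F n), (∀ s' ∈ L', R' s') ∧ ∀ t, IsGeneric t →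
      (L.map fun s' => s'.ind t).sum = (L'.map fun s' => s'.ind t).sum := by
    clear hsum
    induction L with
    | nil => exact ⟨[], by simp, by simp⟩
    | cons x L ih =>
      obtain ⟨L₁, h₁, e₁⟩ := ih fun s' hs' => hL s' (List.mem_cons_of_mem _ hs')
      obtain ⟨L₂, h₂, e₂⟩ := hR x (hL x List.mem_cons_self)
      refine ⟨L₂ ++ L₁, fun s' hs' => ?_, fun t ht => ?_⟩
      · rcases List.mem_append.mp hs' with h | h
        exacts [h₂ s' h, h₁ s' h]
      · simp [e₁ t ht, e₂ t ht]
  obtain ⟨L', hL', e'⟩ := key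
  exact ⟨L', hL', fun t ht => (hsum t ht).trans (e' t ht)⟩

theorem trace_mul_sum (c : F) (q : Fin n → ℚ) (v : Fin n → F) :
    Algebra.trace ℚ F (c * ∑ i, (q i : F) * v i) = ∑ i, q i * Algebra.trace ℚ F (c * v i) := by
  rw [Finset.mul_sum, map_sum]
  refine Finset.sum_congr rfl fun i _ => ?_
  rw [mul_left_comm, ← smul_eq_mul (q i), ← map_smul, Algebra.smul_def]
  simp

theorem dual_sum {w v : Fin n → F} (h : IsTraceDual w v) (q : Fin n → ℚ) (i : Fin n) :
    Algebra.trace ℚ F (w i * ∑ i, (q i : F) * v i) = q i := by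
  rw [trace_mul_sum]
  simp [h i]

/-- The star subdivision at `p = ∑ q_i v_i`: the generator `v_j` is replaced by `p`. -/
def star (s : PosSimplex F n) (q : Fin n → ℚ) (hq : ∀ i, 0 ≤ q i) (j : Fin n) (hj : 0 < q j) :
    PosSimplex F n where
  w i := if i = j then ((q j)⁻¹ : ℚ) * s.w j else s.w i - ((q i / q j : ℚ) : F) * s.w j
  v := Function.update s.v j (∑ i, (q i : F) * s.v i)
  dual := by
    have hrat (r : ℚ) (x : F) : Algebra.trace ℚ F ((r : F) * x) = r * Algebra.trace ℚ F x := by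
      rw [← smul_eq_mul r, ← map_smul, Algebra.smul_def]; simp
    intro i k
    dsimp only
    by_cases hk : k = j
    · subst hk
      rw [Function.update_self]
      split_ifs with hi
      · rw [mul_assoc, hrat, dual_sum s.dual, inv_mul_cancel₀ hj.ne']
      · rw [sub_mul, map_sub, mul_assoc, hrat, dual_sum s.dual, dual_sum s.dual,
          div_mul_cancel₀ _ hj.ne', sub_self]
    · rw [Function.update_of_ne hk]
      by_cases hi : i = j
      · rw [if_pos hi, mul_assoc, hrat, s.dual, if_neg (Ne.symm hk), mul_zero,
          if_neg fun h : i = k => hk (h.symm.trans hi)]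
      · rw [if_neg hi, sub_mul, map_sub, mul_assoc, hrat, s.dual, s.dual, if_neg (Ne.symm hk),
          mul_zero, sub_zero]
  pos k τ := by
    by_cases hk : k = j
    · subst hk
      rw [Function.update_self, map_sum]
      refine Finset.sum_pos' (fun i _ => ?_) ⟨k, Finset.mem_univ _, ?_⟩
      · rw [map_mul, map_ratCast]
        exact mul_nonneg (by exact_mod_cast hq i) (s.pos i τ).le
      · rw [map_mul, map_ratCast]
        exact mul_pos (by exact_mod_cast hj) (s.pos k τ)
    · rw [Function.update_of_ne hk]
      exact s.pos k τ

theorem star_v_self (s : PosSimplex F n) (q : Fin n → ℚ) (hq : ∀ i, 0 ≤ q i) (j : Fin n)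
    (hj : 0 < q j) : (s.star q hq j hj).v j = ∑ i, (q i : F) * s.v i :=
  Function.update_self _ _ _

theorem star_v_of_ne (s : PosSimplex F n) (q : Fin n → ℚ) (hq : ∀ i, 0 ≤ q i) {i j : Fin n}
    (hj : 0 < q j) (hij : i ≠ j) : (s.star q hq j hj).v i = s.v i :=
  Function.update_of_ne hij _ _

theorem pair_star_self (s : PosSimplex F n) (q : Fin n → ℚ) (hq : ∀ i, 0 ≤ q i) (j : Fin n)
    (hj : 0 < q j) (t : (F →+* ℝ) → ℝ) :
    pair t ((s.star q hq j hj).w j) = (q j : ℝ)⁻¹ * pair t (s.w j) := by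
  simp only [star, if_true]
  rw [pair_ratCast_mul, Rat.cast_inv]

theorem pair_star_of_ne (s : PosSimplex F n) (q : Fin n → ℚ) (hq : ∀ i, 0 ≤ q i) {i j : Fin n}
    (hj : 0 < q j) (hij : i ≠ j) (t : (F →+* ℝ) → ℝ) :
    pair t ((s.star q hq j hj).w i) =
      pair t (s.w i) - (q i : ℝ) / (q j : ℝ) * pair t (s.w j) := by
  simp only [star, if_neg hij]
  have := pair_ratCast_mul t (-(q i / q j)) (s.w j)
  rw [sub_eq_add_neg, pair_add, ← neg_mul, ← Rat.cast_neg, this]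
  push_cast
  ring

/-- With `z_i = ⟨t, w_i⟩`, the point `t` lies in the piece where `v_j` is replaced by `∑ q_i v_i`
exactly when `z_j / q_j` is the strict minimum of the ratios with `q_i > 0`. For generic `t` there
are no ties. -/
theorem subdivides_star (s : PosSimplex F n) (q : Fin n → ℚ) (hq : ∀ i, 0 ≤ q i)
    (hne : ∃ j, 0 < q j) : Subdivides (fun s' => ∃ j hj, s' = s.star q hq j hj) s := by
  refine ⟨(Finset.univ : Finset {j // 0 < q j}).toList.map fun j => s.star q hq j.1 j.2,
    fun s' hs' => ?_, fun t ht => ?_⟩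
  · obtain ⟨j, -, rfl⟩ := List.mem_map.mp hs'
    exact ⟨j.1, j.2, rfl⟩
  · have hqR (j : {j // 0 < q j}) : (0 : ℝ) < q j.1 := by exact_mod_cast j.2
    have hqR0 (i : Fin n) : (0 : ℝ) ≤ q i := by exact_mod_cast hq i
    rw [List.map_map]
    change _ = ((Finset.univ : Finset {j // 0 < q j}).toList.map
      fun j => (s.star q hq j.1 j.2).ind t).sum
    rw [Finset.sum_map_toList]
    by_cases hmem : t ∈ dualRegion s.w
    · have : Nonempty {j // 0 < q j} := ⟨⟨hne.choose, hne.choose_spec⟩⟩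
      obtain ⟨j, hj⟩ := Finite.exists_min fun j : {j // 0 < q j} =>
        pair t (s.w j.1) / (q j.1 : ℝ)
      have hstar : t ∈ dualRegion (s.star q hq j.1 j.2).w := by
        intro i
        by_cases hij : i = j.1
        · subst hij
          rw [pair_star_self]
          exact mul_pos (inv_pos.mpr (hqR j)) (hmem j.1)
        -- Minimality of the ratio gives only `≤`; genericity of `t` makes it strict.
        · refine lt_of_le_of_ne ?_ (ht _ (w_ne_zero _ i)).symm
          rw [pair_star_of_ne s q hq j.2 hij]
          rcases (hqR0 i).eq_or_lt with h0 | h0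
          · rw [← h0]
            simpa using (hmem i).le
          · have hmin : pair t (s.w j.1) / (q j.1 : ℝ) ≤ pair t (s.w i) / (q i : ℝ) :=
              hj ⟨i, by exact_mod_cast h0⟩
            rw [le_div_iff₀ h0] at hmin
            have : (q i : ℝ) / q j.1 * pair t (s.w j.1) = pair t (s.w j.1) / q j.1 * q i := by
              ring
            rw [this]
            linarith
      rw [Finset.sum_eq_single j, ind_of_mem hmem, ind_of_mem hstar]
      · intro k _ hkj
        refine ind_of_notMem fun hk => ?_
        have hkj' : k.1 ≠ j.1 := fun h => hkj (Subtype.ext h)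
        have h1 := hk j.1
        rw [pair_star_of_ne s q hq k.2 hkj'.symm] at h1
        have h2 := hj k
        rw [div_le_div_iff₀ (hqR j) (hqR k)] at h2
        have h3 : 0 < (pair t (s.w j.1) - q j.1 / q k.1 * pair t (s.w k.1)) * q k.1 :=
          mul_pos h1 (hqR k)
        have h4 : (pair t (s.w j.1) - q j.1 / q k.1 * pair t (s.w k.1)) * q k.1 =
            pair t (s.w j.1) * q k.1 - pair t (s.w k.1) * q j.1 := by
          have := (hqR k).ne'
          field_simp
        linarith
      · simp
    · rw [ind_of_notMem hmem, eq_comm, Finset.sum_eq_zero_iff]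
      intro j _
      refine ind_of_notMem fun hj => hmem fun i => ?_
      have hzj : 0 < pair t (s.w j.1) := by
        have := hj j.1
        rw [pair_star_self] at this
        exact pos_of_mul_pos_right this (inv_pos.mpr (hqR j)).le
      by_cases hij : i = j.1
      · rw [hij]; exact hzj
      · have := hj i
        rw [pair_star_of_ne s q hq j.2 hij] at this
        have : 0 ≤ (q i : ℝ) / q j.1 * pair t (s.w j.1) :=
          mul_nonneg (div_nonneg (hqR0 i) (hqR j).le) hzj.le
        linarith

/-- On the generic points of the cone the sign of `⟨t, c⟩` is constant. -/
def Decides (c : F) (s : PosSimplex F n) : Prop :=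
  (∀ t, IsGeneric t → t ∈ dualRegion s.w → 0 < pair t c) ∨
    ∀ t, IsGeneric t → t ∈ dualRegion s.w → ¬ 0 < pair t c

/-- If all generators lie weakly on one side of the hyperplane of `c`, the sign is decided.
Otherwise two generators lie strictly on opposite sides; subdividing where their edge meets the
hyperplane lowers the number of generators off it. -/
theorem subdivides_decides (hn : finrank ℚ F = n) (c : F) (s : PosSimplex F n) :
    Subdivides (Decides c) s := by
  induction hN : (Finset.univ.filter fun i => Algebra.trace ℚ F (c * s.v i) ≠ 0).card using
    Nat.strong_induction_on generalizing s with
  | _ N ih =>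
  by_cases hc : c = 0
  · exact Subdivides.refl (Or.inr fun t _ _ => by simp [hc, pair])
  by_cases h1 : ∀ i, 0 ≤ Algebra.trace ℚ F (c * s.v i)
  · refine Subdivides.refl (Or.inl fun t ht hmem => lt_of_le_of_ne ?_ (ht c hc).symm)
    rw [s.dual.pair_eq hn]
    exact Finset.sum_nonneg fun j _ => mul_nonneg (by exact_mod_cast h1 j) (hmem j).le
  by_cases h2 : ∀ i, Algebra.trace ℚ F (c * s.v i) ≤ 0
  · refine Subdivides.refl (Or.inr fun t ht hmem => not_lt.mpr ?_)
    rw [s.dual.pair_eq hn]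
    exact Finset.sum_nonpos fun j _ =>
      mul_nonpos_of_nonpos_of_nonneg (by exact_mod_cast h2 j) (hmem j).le
  push Not at h1 h2
  obtain ⟨k, hk⟩ := h1
  obtain ⟨j, hj⟩ := h2
  have hjk : j ≠ k := by rintro rfl; exact lt_asymm hj hk
  set T : Fin n → ℚ := fun i => Algebra.trace ℚ F (c * s.v i) with hT
  -- The point `-T_k v_j + T_j v_k` of the edge is annihilated by `c`, and both coefficients are
  -- positive.
  let q : Fin n → ℚ := Function.update (Function.update 0 j (-T k)) k (T j)
  have hqk : q k = T j := by simp [q]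
  have hqj : q j = -T k := by simp [q, hjk]
  have hqo (i) (hij : i ≠ j) (hik : i ≠ k) : q i = 0 := by simp [q, hij, hik]
  have hq (i : Fin n) : 0 ≤ q i := by
    by_cases hik : i = k
    · rw [hik, hqk]; exact hj.le
    by_cases hij : i = j
    · rw [hij, hqj]; exact neg_nonneg.mpr hk.le
    rw [hqo i hij hik]
  have hTp : Algebra.trace ℚ F (c * ∑ i, (q i : F) * s.v i) = 0 := by
    rw [trace_mul_sum, Finset.sum_eq_add_of_mem j k (Finset.mem_univ _) (Finset.mem_univ _) hjk
      fun i _ hi => by rw [hqo i hi.1 hi.2, zero_mul], hqj, hqk]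
    change -T k * T j + T j * T k = 0
    ring
  refine (subdivides_star s q hq ⟨k, by rw [hqk]; exact hj⟩).bind ?_
  rintro s' ⟨l, hl, rfl⟩
  have hlT : T l ≠ 0 := by
    by_cases hlk : l = k
    · rw [hlk]; exact hk.ne
    by_cases hlj : l = j
    · rw [hlj]; exact hj.ne'
    · rw [hqo l hlj hlk] at hl
      exact absurd hl (lt_irrefl _)
  refine ih _ ?_ _ rfl
  rw [← hN]
  refine Finset.card_lt_card (Finset.ssubset_iff_of_subset ?_ |>.mpr ⟨l, by simpa using hlT, ?_⟩)
  · intro i hi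
    rw [Finset.mem_filter] at hi ⊢
    by_cases hil : i = l
    · rw [hil]; exact ⟨Finset.mem_univ _, hlT⟩
    · rwa [star_v_of_ne _ _ _ _ hil] at hi
  · rw [Finset.mem_filter, star_v_self]
    exact fun h => h.2 hTp

theorem Decides.of_subset {c : F} {s s' : PosSimplex F n} (h : Decides c s)
    (hs : ∀ t, IsGeneric t → t ∈ dualRegion s'.w → t ∈ dualRegion s.w) : Decides c s' :=
  h.imp (fun h t ht hm => h t ht (hs t ht hm)) fun h t ht hm => h t ht (hs t ht hm)

theorem subdivides_decides_finset (hn : finrank ℚ F = n) (cs : Finset F) (s : PosSimplex F n) :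
    Subdivides (fun s' => ∀ c ∈ cs, Decides c s') s := by
  classical
  induction cs using Finset.induction_on with
  | empty => exact Subdivides.refl (by simp)
  | insert c cs _ ih =>
    refine ih.bind fun s' hs' => (subdivides_decides hn c s').mono fun s'' h hsub => ?_
    intro d hd
    rcases Finset.mem_insert.mp hd with rfl | hd
    · exact h
    · exact (hs' d hd).of_subset hsub

variable {a : FractionalIdeal (𝓞 F)⁰ F} {w₀ v₀ : Fin n → F}

/-- The two integrality conditions say that each of the lattices spanned by `w₀` and `w` contains
the other. -/
theorem isIntBasis_of_integral (h₀ : IsIntBasis a w₀) (hd : IsTraceDual w₀ v₀)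
    (hn : finrank ℚ F = n) {w v : Fin n → F} (h : IsTraceDual w v)
    (h1 : ∀ i j, ∃ m : ℤ, Algebra.trace ℚ F (w₀ i * v j) = m)
    (h2 : ∀ i j, ∃ m : ℤ, Algebra.trace ℚ F (w i * v₀ j) = m) : IsIntBasis a w := by
  have hspan : Submodule.span ℤ (range w) = Submodule.span ℤ (range w₀) := by
    refine le_antisymm (Submodule.span_le.mpr ?_) (Submodule.span_le.mpr ?_)
    · rintro _ ⟨i, rfl⟩
      rw [hd.eq_sum hn (w i)]
      refine Submodule.sum_mem _ fun j _ => ?_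
      obtain ⟨m, hm⟩ := h2 i j
      rw [hm, Rat.cast_intCast, ← zsmul_eq_mul]
      exact Submodule.smul_mem _ _ (Submodule.subset_span ⟨j, rfl⟩)
    · rintro _ ⟨i, rfl⟩
      rw [h.eq_sum hn (w₀ i)]
      refine Submodule.sum_mem _ fun j _ => ?_
      obtain ⟨m, hm⟩ := h1 i j
      rw [hm, Rat.cast_intCast, ← zsmul_eq_mul]
      exact Submodule.smul_mem _ _ (Submodule.subset_span ⟨j, rfl⟩)
  exact ⟨h.linearIndependent.restrict_scalars' ℤ, fun x => by rw [hspan]; exact h₀.2 x⟩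

theorem det_trace_ne_zero (hd : IsTraceDual w₀ v₀) (hn : finrank ℚ F = n) {w v : Fin n → F}
    (h : IsTraceDual w v) :
    (Matrix.of fun i j => Algebra.trace ℚ F (w₀ i * v j)).det ≠ 0 := by
  have hmul : (Matrix.of fun i j => Algebra.trace ℚ F (w₀ i * v j)) *
      (Matrix.of fun i j => Algebra.trace ℚ F (w i * v₀ j)) = 1 := by
    ext i k
    rw [Matrix.mul_apply, Matrix.one_apply, ← hd i k]
    conv_rhs => rw [h.eq_sum hn (w₀ i), mul_comm, trace_mul_sum]
    exact Finset.sum_congr rfl fun j _ => by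
      rw [Matrix.of_apply, Matrix.of_apply, mul_comm (v₀ k)]
  intro h0
  have := congrArg Matrix.det hmul
  rw [Matrix.det_mul, h0, zero_mul, Matrix.det_one] at this
  exact zero_ne_one this

/-- This is the toric desingularisation argument. `|det M|` is the index of the lattice of the
generators in the dual lattice spanned by `v₀`. If the lattices differ, star subdivision at a point
of the dual lattice with coefficients in `[0,1)` strictly lowers this index. -/
theorem subdivides_isIntBasis_of_integral (h₀ : IsIntBasis a w₀) (hd : IsTraceDual w₀ v₀)
    (hn : finrank ℚ F = n) (s : PosSimplex F n) (M : Matrix (Fin n) (Fin n) ℤ)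
    (hM : ∀ i j, Algebra.trace ℚ F (w₀ i * s.v j) = M i j) :
    Subdivides (fun s' => IsIntBasis a s'.w) s := by
  induction hN : M.det.natAbs using Nat.strong_induction_on generalizing s M with
  | _ N ih =>
  by_cases hall : ∀ i j, ∃ m : ℤ, Algebra.trace ℚ F (s.w i * v₀ j) = m
  · exact Subdivides.refl
      (isIntBasis_of_integral h₀ hd hn s.dual (fun i j => ⟨M i j, hM i j⟩) hall)
  push Not at hall
  obtain ⟨i₀, j₀, hij⟩ := hall
  let r : Fin n → ℚ := fun i => Algebra.trace ℚ F (s.w i * v₀ j₀)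
  -- The `r_i` are the coordinates of `v₀ j₀` in the generators. Dropping integer parts subtracts
  -- lattice vectors, so `∑ q_i v_i` stays in the dual lattice, and `q i₀ ≠ 0` because `r i₀` is not
  -- an integer.
  let q : Fin n → ℚ := fun i => Int.fract (r i)
  have hq (i) : 0 ≤ q i := Int.fract_nonneg _
  have hq1 (i) : q i < 1 := Int.fract_lt_one _
  have hq0 : 0 < q i₀ := by
    refine lt_of_le_of_ne (hq i₀) fun h => hij ⌊r i₀⌋ ?_
    exact ((Int.self_sub_floor (r i₀)).trans h.symm |> sub_eq_zero.mp)
  have hp (i : Fin n) : Algebra.trace ℚ F (w₀ i * ∑ k, (q k : F) * s.v k) =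
      (((if i = j₀ then 1 else 0) - ∑ k, ⌊r k⌋ * M i k : ℤ) : ℚ) := by
    rw [trace_mul_sum]
    have h1 : ∑ k, r k * Algebra.trace ℚ F (w₀ i * s.v k) = if i = j₀ then 1 else 0 := by
      rw [← hd i j₀, ← trace_mul_sum]
      congr 2
      conv_rhs => rw [s.dual.symm.eq_sum hn (v₀ j₀)]
      simp only [r, mul_comm]
    push_cast
    rw [← h1, ← Finset.sum_sub_distrib]
    refine Finset.sum_congr rfl fun k _ => ?_
    rw [← hM, ← sub_mul]
    rfl
  refine (subdivides_star s q hq ⟨i₀, hq0⟩).bind ?_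
  rintro s' ⟨j, hj, rfl⟩
  let M' : Matrix (Fin n) (Fin n) ℤ := fun i k =>
    if k = j then (if i = j₀ then 1 else 0) - ∑ k, ⌊r k⌋ * M i k else M i k
  have hM' (i k) : Algebra.trace ℚ F (w₀ i * (s.star q hq j hj).v k) = M' i k := by
    by_cases hk : k = j
    · subst hk
      simp only [star, Function.update_self, M', if_true]
      exact hp i
    · simp only [star, Function.update_of_ne hk, M', if_neg hk]
      exact hM i k
  refine ih _ ?_ _ M' hM' rfl
  rw [← hN]
  have hcast (A : Matrix (Fin n) (Fin n) ℤ) :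
      ((A.det : ℤ) : ℚ) = (A.map (Int.cast : ℤ → ℚ)).det := by
    simpa using (RingHom.map_det (Int.castRingHom ℚ) A)
  have hdetM : ((M.det : ℤ) : ℚ) ≠ 0 := by
    rw [hcast]
    convert det_trace_ne_zero hd hn s.dual using 2
    ext i k
    exact (hM i k).symm
  -- Replacing column `j` by the combination of the columns with coefficients `q` multiplies the
  -- determinant by `q j`, which is less than one.
  have hdet' : ((M'.det : ℤ) : ℚ) = q j * (M.det : ℤ) := by
    rw [hcast, hcast, ← smul_eq_mul, ← Matrix.det_updateCol_sum]
    congr 1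
    ext i k
    rw [Matrix.map_apply, ← hM', Matrix.updateCol_apply]
    by_cases hk : k = j
    · subst hk
      simp only [star, Function.update_self, if_true]
      rw [trace_mul_sum]
      exact Finset.sum_congr rfl fun l _ => by rw [hM, smul_eq_mul]; rfl
    · simp only [star, Function.update_of_ne hk, if_neg hk]
      exact hM i k
  have : |((M'.det : ℤ) : ℚ)| < |((M.det : ℤ) : ℚ)| := by
    rw [hdet', abs_mul, abs_of_pos hj]
    exact mul_lt_of_lt_one_left (abs_pos.mpr hdetM) (hq1 j)
  have h3 : |M'.det| < |M.det| := by exact_mod_cast this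
  rw [Int.abs_eq_natAbs, Int.abs_eq_natAbs] at h3
  exact_mod_cast h3

/-- The same cone with generators multiplied by a positive integer. -/
def scale (s : PosSimplex F n) (d : ℕ) (hd : 0 < d) : PosSimplex F n where
  w i := (((d : ℚ)⁻¹ : ℚ) : F) * s.w i
  v i := (d : F) * s.v i
  dual i j := by
    have : (((d : ℚ)⁻¹ : ℚ) : F) * s.w i * ((d : F) * s.v j) = s.w i * s.v j := by
      have : (d : F) ≠ 0 := by exact_mod_cast hd.ne'
      push_cast
      field_simp
    rw [this, s.dual]
  pos j τ := by
    rw [map_mul, map_natCast]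
    exact mul_pos (by exact_mod_cast hd) (s.pos j τ)

theorem ind_scale (s : PosSimplex F n) (d : ℕ) (hd : 0 < d) (t : (F →+* ℝ) → ℝ) :
    (s.scale d hd).ind t = s.ind t := by
  have : dualRegion (s.scale d hd).w = dualRegion s.w := by
    ext t
    refine forall_congr' fun j => ?_
    simp only [scale]
    rw [pair_ratCast_mul]
    have : (0 : ℝ) < ((d : ℚ)⁻¹ : ℚ) := by
      have : (0 : ℚ) < (d : ℚ)⁻¹ := by positivity
      exact_mod_cast this
    exact mul_pos_iff_of_pos_left this
  rw [ind, this, ind]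

/-- Scaling the generators by a common denominator `d` does not change the cone and puts them in the
dual lattice. -/
theorem subdivides_isIntBasis (h₀ : IsIntBasis a w₀) (hd : IsTraceDual w₀ v₀)
    (hn : finrank ℚ F = n) (s : PosSimplex F n) :
    Subdivides (fun s' => IsIntBasis a s'.w) s := by
  let T : Fin n → Fin n → ℚ := fun i j => Algebra.trace ℚ F (w₀ i * s.v j)
  let d : ℕ := ∏ p : Fin n × Fin n, (T p.1 p.2).den
  have hdpos : 0 < d := Finset.prod_pos fun p _ => (T p.1 p.2).den_pos
  have hint (i j) : ∃ m : ℤ, Algebra.trace ℚ F (w₀ i * (s.scale d hdpos).v j) = m := by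
    obtain ⟨e, he⟩ : (T i j).den ∣ d :=
      Finset.dvd_prod_of_mem (fun p : Fin n × Fin n => (T p.1 p.2).den) (Finset.mem_univ (i, j))
    refine ⟨e * (T i j).num, ?_⟩
    simp only [scale]
    have h1 : w₀ i * ((d : F) * s.v j) = (d : ℚ) • (w₀ i * s.v j) := by
      rw [Algebra.smul_def]; simp; ring
    rw [h1, map_smul, smul_eq_mul]
    change (d : ℚ) * T i j = _
    rw [he]
    push_cast
    rw [mul_comm ((T i j).den : ℚ), mul_assoc, Rat.den_mul_eq_num]
  choose M hM using hint
  obtain ⟨L, hL, hsum⟩ := subdivides_isIntBasis_of_integral h₀ hd hn (s.scale d hdpos) M hM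
  exact ⟨L, hL, fun t ht => by rw [← ind_scale s d hdpos, hsum t ht]⟩

end PosSimplex

/-! ### Dirichlet's unit theorem for totally positive units. -/

section Units

variable {F : Type*} [Field F] [NumberField F] [IsTotallyReal F]

theorem mk_realEmb_injective :
    Function.Injective fun τ : F →+* ℝ => InfinitePlace.mk (Complex.ofRealHom.comp τ) := by
  intro τ σ h
  have : Complex.ofRealHom.comp τ = Complex.ofRealHom.comp σ := by
    rcases InfinitePlace.mk_eq_iff.mp h with h | h
    · exact h
    · rw [← h]
      ext x
      simp
  ext x
  exact Complex.ofReal_injective (RingHom.congr_fun this x)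

variable (F) in
/-- Dirichlet's unit theorem: the logarithms of the totally positive units are cobounded in the
hyperplane of vectors with coordinate sum zero. -/
theorem exists_unit_log_sub_le :
    ∃ C : ℝ, ∀ y : (F →+* ℝ) → ℝ, ∑ τ, y τ = 0 →
      ∃ u : totPosUnits F, ∀ τ : F →+* ℝ, |Real.log (τ (unitVal u)) - y τ| ≤ C := by
  classical
  let place : (F →+* ℝ) → InfinitePlace F := fun τ => InfinitePlace.mk (Complex.ofRealHom.comp τ)
  have hplace (τ : F →+* ℝ) (x : F) : place τ x = |τ x| := by
    change ‖((τ x : ℝ) : ℂ)‖ = _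
    rw [Complex.norm_real, Real.norm_eq_abs]
  let b := (Units.basisUnitLattice F).ofZLatticeBasis ℝ (Units.unitLattice F)
  set B : ℝ := ∑ i, ‖b i‖ with hB
  have hB0 : 0 ≤ B := Finset.sum_nonneg fun _ _ => norm_nonneg _
  have hcard : (0 : ℝ) ≤ Fintype.card (F →+* ℝ) := Nat.cast_nonneg _
  refine ⟨(Fintype.card (F →+* ℝ) + 1) * (2 * B), fun y hy => ?_⟩
  -- The target is halved because the unit `η'` found near it is squared to become totally positive.
  let x : Units.dirichletUnitTheorem.logSpace F := fun w => y (Function.invFun place w.1) / 2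
  have hmem : (ZSpan.floor b x : Units.dirichletUnitTheorem.logSpace F) ∈ Units.unitLattice F := by
    rw [← (Units.basisUnitLattice F).ofZLatticeBasis_span ℝ (Units.unitLattice F)]
    exact (ZSpan.floor b x).2
  obtain ⟨η, -, hη⟩ := hmem
  have hle : ‖x - ZSpan.floor b x‖ ≤ B := ZSpan.norm_fract_le b x
  rw [← hη] at hle
  set η' : (𝓞 F)ˣ := Additive.toMul η with hη'
  have hηne (τ : F →+* ℝ) : τ ((η' : 𝓞 F) : F) ≠ 0 := by
    rw [map_ne_zero]
    exact (RingOfIntegers.coe_ne_zero_iff).mpr η'.ne_zero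
  have hpos : η' ^ 2 ∈ totPosUnits F := fun τ => by
    have := sq_pos_of_ne_zero (hηne τ)
    simpa using this
  have hlog (τ : F →+* ℝ) : Real.log (τ (unitVal ⟨η' ^ 2, hpos⟩)) =
      2 * Real.log |τ ((η' : 𝓞 F) : F)| := by
    simp [unitVal]
  have hsmall (τ : F →+* ℝ) (hτ : place τ ≠ Units.dirichletUnitTheorem.w₀) :
      |Real.log (τ (unitVal ⟨η' ^ 2, hpos⟩)) - y τ| ≤ 2 * B := by
    have h1 := (norm_le_pi_norm _ (⟨place τ, hτ⟩ : {w // w ≠ Units.dirichletUnitTheorem.w₀})).trans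
      hle
    have h2 : (x - (Units.logEmbedding F).toIntLinearMap η) ⟨place τ, hτ⟩ =
        y τ / 2 - Real.log |τ ((η' : 𝓞 F) : F)| := by
      change y (Function.invFun place (place τ)) / 2 -
        ((place τ).mult : ℝ) * Real.log (place τ _) = _
      rw [Function.leftInverse_invFun mk_realEmb_injective, IsTotallyReal.mult_eq, hplace]
      simp [hη']
    rw [h2, Real.norm_eq_abs] at h1
    rw [hlog, show 2 * Real.log |τ ((η' : 𝓞 F) : F)| - y τ =
      -(2 * (y τ / 2 - Real.log |τ ((η' : 𝓞 F) : F)|)) by ring, abs_neg, abs_mul, abs_two]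
    linarith
  refine ⟨⟨η' ^ 2, hpos⟩, fun τ => ?_⟩
  by_cases hτ : place τ = Units.dirichletUnitTheorem.w₀
  -- The logarithmic space omits the place `w₀`; its coordinate is recovered from the others, since
  -- all differences sum to zero.
  · have hsum : ∑ σ : F →+* ℝ, (Real.log (σ (unitVal ⟨η' ^ 2, hpos⟩)) - y σ) = 0 := by
      rw [Finset.sum_sub_distrib, hy, sub_zero, ← Real.log_prod fun σ _ => (unitVal_pos _ σ).ne',
        prod_unitVal, Real.log_one]
    rw [← Finset.add_sum_erase _ _ (Finset.mem_univ τ)] at hsum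
    rw [eq_neg_of_add_eq_zero_left hsum, abs_neg]
    calc _ ≤ ∑ σ ∈ Finset.univ.erase τ, |Real.log (σ (unitVal ⟨η' ^ 2, hpos⟩)) - y σ| :=
          Finset.abs_sum_le_sum_abs _ _
      _ ≤ ∑ σ ∈ Finset.univ.erase τ, 2 * B := by
          refine Finset.sum_le_sum fun σ hσ => hsmall σ fun h => ?_
          exact Finset.ne_of_mem_erase hσ (mk_realEmb_injective (h.trans hτ.symm))
      _ ≤ ∑ _σ : F →+* ℝ, 2 * B :=
          Finset.sum_le_sum_of_subset_of_nonneg (Finset.erase_subset _ _)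
            fun _ _ _ => by positivity
      _ ≤ _ := by
          simp only [Finset.sum_const, Finset.card_univ, nsmul_eq_mul]
          nlinarith
  · refine (hsmall τ hτ).trans ?_
    nlinarith

-- A unit can move `log t` to within `C` of the constant vector given by its mean, so any two
-- coordinates then have ratio at most `exp (2C)`.
variable (F) in
theorem exists_unit_ratio_le :
    ∃ M : ℝ, ∀ t ∈ orthant F, ∃ u : totPosUnits F, ∀ τ σ : F →+* ℝ,
      t τ * τ (unitVal u) ≤ M * (t σ * σ (unitVal u)) := by
  obtain ⟨C, hC⟩ := exists_unit_log_sub_le F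
  refine ⟨Real.exp (2 * C), fun t ht => ?_⟩
  set m : ℝ := (∑ τ, Real.log (t τ)) / Fintype.card (F →+* ℝ) with hm
  have hcard : (Fintype.card (F →+* ℝ) : ℝ) ≠ 0 := by
    exact_mod_cast Fintype.card_ne_zero
  obtain ⟨u, hu⟩ := hC (fun τ => m - Real.log (t τ)) (by
    rw [Finset.sum_sub_distrib, hm]
    simp only [Finset.sum_const, Finset.card_univ, nsmul_eq_mul]
    field_simp
    ring)
  have hlog (τ : F →+* ℝ) : |Real.log (t τ * τ (unitVal u)) - m| ≤ C := by
    rw [Real.log_mul (ht τ).ne' (unitVal_pos u τ).ne']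
    have := hu τ
    rwa [show Real.log (τ (unitVal u)) - (m - Real.log (t τ)) =
      Real.log (t τ) + Real.log (τ (unitVal u)) - m by ring] at this
  have hpos (τ : F →+* ℝ) : 0 < t τ * τ (unitVal u) := mul_pos (ht τ) (unitVal_pos u τ)
  refine ⟨u, fun τ σ => ?_⟩
  rw [← Real.log_le_log_iff (hpos τ) (mul_pos (Real.exp_pos _) (hpos σ)),
    Real.log_mul (Real.exp_ne_zero _) (hpos σ).ne', Real.log_exp]
  have h1 := abs_le.mp (hlog τ)
  have h2 := abs_le.mp (hlog σ)
  linarith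

/-- There are only finitely many algebraic integers of `F` with all conjugates bounded by `M`. -/
theorem finite_units_le (M : ℝ) :
    {u : totPosUnits F | ∀ τ : F →+* ℝ, τ (unitVal u) ≤ M}.Finite := by
  refine Finite.of_finite_image
    ((Embeddings.finite_of_norm_le F ℂ M).subset ?_) unitVal_injective.injOn
  rintro _ ⟨u, hu, rfl⟩
  refine ⟨RingOfIntegers.isIntegral_coe _, fun φ => ?_⟩
  have h := realEmbEquiv_apply ((realEmbEquiv F).symm φ.toRatAlgHom) (unitVal u)
  rw [Equiv.apply_symm_apply] at h
  change φ (unitVal u) = _ at h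
  rw [h, Complex.norm_real, Real.norm_of_nonneg (unitVal_pos u _).le]
  exact hu _

end Units

/-! ### Finite covers of the orthant modulo units. -/

section Cover

variable {F : Type*} [Field F] [NumberField F] [IsTotallyReal F] {n : ℕ}

theorem denseRange_embeddings (hn : finrank ℚ F = n) :
    DenseRange fun (x : F) (τ : F →+* ℝ) => τ x := by
  let b := Module.finBasisOfFinrankEq ℚ F hn
  obtain ⟨v, hv⟩ := exists_isTraceDual b
  let L : (Fin n → ℝ) → (F →+* ℝ) → ℝ := fun z τ => ∑ j, z j * τ (v j)
  have hL : Continuous L := by fun_prop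
  have hsurj : Function.Surjective L := fun t =>
    ⟨fun j => pair t (b j), funext fun τ => (hv.apply_eq hn t τ).symm⟩
  have hd : DenseRange (Pi.map fun (_ : Fin n) (q : ℚ) => (q : ℝ)) :=
    DenseRange.piMap fun _ => Rat.denseRange_cast
  refine (hsurj.denseRange.comp hd hL).mono ?_
  rintro _ ⟨q, rfl⟩
  exact ⟨∑ j, (q j : F) * v j, by ext τ; simp [L]⟩

/-- Having positive entries and containing `t` in the open cone they generate is an open condition
on `n`-tuples of real vectors. Some real tuple satisfies it, and tuples coming from `F` are dense.
-/
theorem exists_posSimplex_mem (hn : finrank ℚ F = n) {t : (F →+* ℝ) → ℝ} (ht : t ∈ orthant F) :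
    ∃ s : PosSimplex F n, t ∈ dualRegion s.w := by
  have e : Fin n ≃ (F →+* ℝ) := (Fintype.equivFinOfCardEq ((card_realEmb F).trans hn)).symm
  let t' : Fin n → ℝ := fun i => t (e i)
  let A : ((j : Fin n) → (F →+* ℝ) → ℝ) → Matrix (Fin n) (Fin n) ℝ :=
    fun B => Matrix.of fun i j => B j (e i)
  have hA : Continuous A := by
    exact continuous_matrix fun i j => continuous_apply_apply j (e i)
  -- By Cramer's rule the second condition says that `det ≠ 0` and that the coordinates of `t` are
  -- positive; multiplying by the determinant avoids division and keeps the condition visibly open.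
  let O : Set ((j : Fin n) → (F →+* ℝ) → ℝ) :=
    {B | (∀ j τ, 0 < B j τ) ∧ ∀ j, 0 < (A B).det * (A B).cramer t' j}
  have hO : IsOpen O := by
    have hO_eq : O = (⋂ j, ⋂ τ, {B | 0 < B j τ}) ∩
        ⋂ j, {B | 0 < (A B).det * (A B).cramer t' j} := by
      ext B; simp [O]
    rw [hO_eq]
    refine IsOpen.inter ?_ ?_
    · exact isOpen_iInter_of_finite fun j => isOpen_iInter_of_finite fun τ =>
        isOpen_lt continuous_const (continuous_apply_apply j τ)
    · exact isOpen_iInter_of_finite fun j => isOpen_lt continuous_const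
        (hA.matrix_det.mul ((continuous_apply j).comp (hA.matrix_cramer continuous_const)))
  have hcr (B : (j : Fin n) → (F →+* ℝ) → ℝ) :
      (A B).mulVec ((A B).cramer t') = (A B).det • t' := Matrix.mulVec_cramer _ _
  have hne : O.Nonempty := by
    classical
    -- The vector `t` with one coordinate doubled. These `n` vectors sum to `(n+1) t`, so all
    -- coordinates of `t` are `1/(n+1)`, and the matrix is a diagonal matrix times a rank-one
    -- perturbation of the identity.
    let B₀ : (j : Fin n) → (F →+* ℝ) → ℝ := fun j τ => t τ + if τ = e j then t τ else 0
    have hA0 : A B₀ = Matrix.diagonal t' * (1 + Matrix.replicateCol Unit (fun _ => (1 : ℝ)) *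
        Matrix.replicateRow Unit (fun _ => (1 : ℝ))) := by
      ext i j
      rw [Matrix.diagonal_mul]
      simp only [A, B₀, Matrix.of_apply, Matrix.add_apply, Matrix.one_apply, Matrix.mul_apply,
        e.injective.eq_iff]
      simp only [Matrix.replicateCol_apply, Matrix.replicateRow_apply, mul_one, Finset.univ_unique,
        Finset.sum_const, Finset.card_singleton, one_smul, t']
      split_ifs <;> ring
    have hdet : (A B₀).det ≠ 0 := by
      rw [hA0, Matrix.det_mul, Matrix.det_diagonal,
        Matrix.det_one_add_replicateCol_mul_replicateRow]
      refine mul_ne_zero (Finset.prod_ne_zero_iff.mpr fun i _ => (ht (e i)).ne') ?_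
      simp only [dotProduct, mul_one, Finset.sum_const, Finset.card_univ, Fintype.card_fin,
        nsmul_eq_mul]
      positivity
    have hz : (A B₀).mulVec (fun _ => ((n : ℝ) + 1)⁻¹) = t' := by
      ext i
      simp only [Matrix.mulVec, dotProduct, A, B₀, Matrix.of_apply, e.injective.eq_iff]
      rw [← Finset.sum_mul, Finset.sum_add_distrib]
      simp only [Finset.sum_const, Finset.card_univ, Fintype.card_fin, nsmul_eq_mul,
        Finset.sum_ite_eq, Finset.mem_univ, if_true, t']
      field_simp
    have hcr0 : (A B₀).cramer t' = (A B₀).det • fun _ => ((n : ℝ) + 1)⁻¹ := by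
      have h1 : (A B₀).mulVec ((A B₀).cramer t') =
          (A B₀).mulVec ((A B₀).det • fun _ => ((n : ℝ) + 1)⁻¹) := by
        rw [Matrix.mulVec_smul, hz]
        exact hcr B₀
      exact Matrix.mulVec_injective_iff_isUnit.mpr
        ((Matrix.isUnit_iff_isUnit_det _).mpr (Ne.isUnit hdet)) h1
    refine ⟨B₀, fun j τ => ?_, fun j => ?_⟩
    · have := ht τ
      simp only [B₀]
      split_ifs <;> linarith
    · rw [hcr0, Pi.smul_apply, smul_eq_mul, ← mul_assoc]
      exact mul_pos (mul_self_pos.mpr hdet) (by positivity)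
  have hdense : DenseRange (Pi.map fun (_ : Fin n) (x : F) (τ : F →+* ℝ) => τ x) :=
    DenseRange.piMap fun _ => denseRange_embeddings hn
  obtain ⟨_, ⟨hpos, hcram⟩, v, rfl⟩ := hdense.inter_open_nonempty O hO hne
  set B : (j : Fin n) → (F →+* ℝ) → ℝ :=
    Pi.map (fun (_ : Fin n) (x : F) (τ : F →+* ℝ) => τ x) v with hB
  have : Nonempty (Fin n) := ⟨⟨0, hn ▸ finrank_pos⟩⟩
  have hdet : (A B).det ≠ 0 := by
    intro h0
    have := hcram (Classical.arbitrary _)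
    simp [h0] at this
  have hli : LinearIndependent ℚ v := by
    rw [Fintype.linearIndependent_iff]
    intro g hg i
    have h0 : (A B).mulVec (fun j => (g j : ℝ)) = 0 := by
      ext k
      have := congrArg (e k) hg
      simpa [Matrix.mulVec, dotProduct, A, hB, Algebra.smul_def, mul_comm] using this
    have := congrFun (Matrix.eq_zero_of_mulVec_eq_zero hdet h0) i
    simpa using this
  obtain ⟨w, hw⟩ := exists_isTraceDual (basisOfLinearIndependentOfCardEqFinrank hli (by simp [hn]))
  rw [coe_basisOfLinearIndependentOfCardEqFinrank] at hw
  refine ⟨⟨w, v, hw.symm, fun j τ => hpos j τ⟩, fun j => ?_⟩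
  have ht' : t = fun τ => ∑ j, ((A B).cramer t' j / (A B).det) * τ (v j) := by
    ext τ
    obtain ⟨k, rfl⟩ := e.surjective τ
    have h1 := congrFun (hcr B) k
    simp only [Matrix.mulVec, dotProduct, Pi.smul_apply, smul_eq_mul] at h1
    have h2 : ∑ j, ((A B).cramer t' j / (A B).det) * e k (v j) =
        (∑ j, A B k j * (A B).cramer t' j) / (A B).det := by
      rw [Finset.sum_div]
      exact Finset.sum_congr rfl fun j _ => by
        change _ = e k (v j) * _ / _
        ring
    rw [h2, h1, mul_div_cancel_left₀ _ hdet]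
  rw [ht', hw.symm.pair_combination]
  rw [← mul_div_mul_left _ _ hdet]
  exact div_pos (hcram j) (mul_self_pos.mpr hdet)

theorem isOpen_dualRegion (w : Fin n → F) : IsOpen (dualRegion w) := by
  have : dualRegion w = ⋂ j, {t | 0 < pair t (w j)} := by
    ext t; simp [dualRegion]
  rw [this]
  exact isOpen_iInter_of_finite fun j => isOpen_lt continuous_const (continuous_pair _)

theorem pair_smul (c : ℝ) (t : (F →+* ℝ) → ℝ) (x : F) : pair (c • t) x = c * pair t x := by
  simp [pair, Finset.mul_sum, mul_assoc]

/-- Finitely many simplicial cones with totally positive generators in `F`, together with their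
translates by totally positive units, cover the totally positive orthant. -/
theorem exists_finite_cover (hn : finrank ℚ F = n) :
    ∃ S : Finset (PosSimplex F n), ∀ t ∈ orthant F, ∃ u : totPosUnits F, ∃ s ∈ S,
      (fun τ => t τ * τ (unitVal u)) ∈ dualRegion s.w := by
  classical
  obtain ⟨M, hM⟩ := exists_unit_ratio_le F
  -- After a unit and a positive scaling every point of the orthant lies in this compact slice; the
  -- ratio bound keeps it off the boundary of the orthant.
  let K : Set ((F →+* ℝ) → ℝ) := {t | (∀ τ, t τ ∈ Icc (0 : ℝ) 1) ∧
    (∀ τ σ, t τ ≤ M * t σ) ∧ ∑ τ, t τ = 1}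
  have hKsub : K ⊆ orthant F := by
    intro t ht σ
    refine lt_of_le_of_ne (ht.1 σ).1 fun h0 => ?_
    have h1 (τ : F →+* ℝ) : t τ = 0 :=
      le_antisymm (by simpa [← h0] using ht.2.1 τ σ) (ht.1 τ).1
    have := ht.2.2
    simp [h1] at this
  have hK : IsCompact K := by
    have h1 : IsCompact (Set.pi univ fun _ : F →+* ℝ => Icc (0 : ℝ) 1) :=
      isCompact_univ_pi fun _ => isCompact_Icc
    have h2 : IsClosed {t : (F →+* ℝ) → ℝ | (∀ τ σ, t τ ≤ M * t σ) ∧ ∑ τ, t τ = 1} := by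
      have h_eq : {t : (F →+* ℝ) → ℝ | (∀ τ σ, t τ ≤ M * t σ) ∧ ∑ τ, t τ = 1} =
          (⋂ τ, ⋂ σ, {t | t τ ≤ M * t σ}) ∩ {t | ∑ τ, t τ = 1} := by
        ext t; simp
      rw [h_eq]
      refine IsClosed.inter ?_ (isClosed_eq (by fun_prop) continuous_const)
      exact isClosed_iInter fun τ => isClosed_iInter fun σ =>
        isClosed_le (by fun_prop) (by fun_prop)
    refine (h1.inter_right h2).of_isClosed_subset ?_ ?_
    · have : K = (Set.pi univ fun _ : F →+* ℝ => Icc (0 : ℝ) 1) ∩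
          {t : (F →+* ℝ) → ℝ | (∀ τ σ, t τ ≤ M * t σ) ∧ ∑ τ, t τ = 1} := by
        ext t; simp only [K, mem_ofPred_eq, mem_inter_iff, mem_pi, mem_univ, forall_true_left]
      rw [this]
      exact h1.isClosed.inter h2
    · intro t ht
      exact ⟨fun τ _ => ht.1 τ, ht.2⟩
  obtain ⟨S, hS⟩ := hK.elim_finite_subcover (fun s : PosSimplex F n => dualRegion s.w)
    (fun s => isOpen_dualRegion _) fun t ht => mem_iUnion.mpr (exists_posSimplex_mem hn (hKsub ht))
  refine ⟨S, fun t ht => ?_⟩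
  obtain ⟨u, hu⟩ := hM t ht
  set t' : (F →+* ℝ) → ℝ := fun τ => t τ * τ (unitVal u) with ht'
  have hpos (τ) : 0 < t' τ := mul_pos (ht τ) (unitVal_pos u τ)
  have hsum : 0 < ∑ τ, t' τ := Finset.sum_pos (fun τ _ => hpos τ) Finset.univ_nonempty
  set c : ℝ := (∑ τ, t' τ)⁻¹ with hc
  have hc0 : 0 < c := inv_pos.mpr hsum
  have hmem : c • t' ∈ K := by
    refine ⟨fun τ => ⟨(mul_pos hc0 (hpos τ)).le, ?_⟩, fun τ σ => ?_, ?_⟩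
    · rw [Pi.smul_apply, smul_eq_mul, hc, inv_mul_le_one₀ hsum]
      exact Finset.single_le_sum (fun σ _ => (hpos σ).le) (Finset.mem_univ τ)
    · simp only [Pi.smul_apply, smul_eq_mul]
      have := mul_le_mul_of_nonneg_left (hu τ σ) hc0.le
      linarith
    · simp only [Pi.smul_apply, smul_eq_mul]
      rw [← Finset.mul_sum, hc, inv_mul_cancel₀ hsum.ne']
  obtain ⟨s, hs, hts⟩ := mem_iUnion₂.mp (hS hmem)
  refine ⟨u, s, hs, fun j => ?_⟩
  have := hts j
  rw [pair_smul] at this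
  exact pos_of_mul_pos_right this hc0.le

theorem PosSimplex.exists_ratio_le (hn : finrank ℚ F = n) (s : PosSimplex F n) :
    ∃ M : ℝ, 0 < M ∧ ∀ t ∈ dualRegion s.w, ∀ τ σ, t τ ≤ M * t σ := by
  have : Nonempty (Fin n) := ⟨⟨0, hn ▸ finrank_pos⟩⟩
  obtain ⟨p, hp⟩ := Finite.exists_min fun p : Fin n × (F →+* ℝ) => p.2 (s.v p.1)
  obtain ⟨q, hq⟩ := Finite.exists_max fun p : Fin n × (F →+* ℝ) => p.2 (s.v p.1)
  have hp0 := s.pos p.1 p.2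
  have hq0 := s.pos q.1 q.2
  refine ⟨q.2 (s.v q.1) / p.2 (s.v p.1), div_pos hq0 hp0, fun t ht τ σ => ?_⟩
  rw [s.dual.apply_eq hn t τ, s.dual.apply_eq hn t σ, Finset.mul_sum]
  refine Finset.sum_le_sum fun j _ => ?_
  rw [mul_left_comm]
  refine mul_le_mul_of_nonneg_left ?_ (ht j).le
  rw [div_mul_eq_mul_div, le_div_iff₀ hp0]
  exact mul_le_mul (hq (j, τ)) (hp (j, σ)) hp0.le hq0.le

/-- Coordinate ratios are bounded on both cones, and some conjugate of `u` is at most one because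
the norm is one. Hence all conjugates are bounded. -/
theorem PosSimplex.finite_units_meeting (hn : finrank ℚ F = n) (s s' : PosSimplex F n) :
    {u : totPosUnits F | ∃ t ∈ dualRegion s.w,
      (fun τ => t τ * τ (unitVal u)) ∈ dualRegion s'.w}.Finite := by
  obtain ⟨M, hM0, hM⟩ := s.exists_ratio_le hn
  obtain ⟨M', hM0', hM'⟩ := s'.exists_ratio_le hn
  refine (finite_units_le (M' * M)).subset ?_
  rintro u ⟨t, ht, htu⟩ τ
  have hpos := dualRegion_subset_orthant s.dual hn s.pos ht
  obtain ⟨σ, hσ⟩ : ∃ σ : F →+* ℝ, σ (unitVal u) ≤ 1 := by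
    by_contra! h
    have := Finset.prod_lt_prod_of_nonempty (s := (Finset.univ : Finset (F →+* ℝ)))
      (f := fun _ => (1 : ℝ)) (fun _ _ => one_pos) (fun σ _ => h σ) Finset.univ_nonempty
    rw [prod_unitVal, Finset.prod_const_one] at this
    exact lt_irrefl _ this
  have h1 := hM' _ htu τ σ
  have h2 : t σ ≤ M * t τ := hM t ht σ τ
  have h3 : t τ * τ (unitVal u) ≤ t τ * (M' * M) := by
    calc t τ * τ (unitVal u) ≤ M' * (t σ * σ (unitVal u)) := h1
      _ ≤ M' * (t σ * 1) := by
          gcongr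
          exact (hpos σ).le
      _ ≤ M' * (M * t τ * 1) := by gcongr
      _ = t τ * (M' * M) := by ring
  exact le_of_mul_le_mul_left h3 (hpos τ)

end Cover

/-! ### Existence of a weighted unimodular partition. -/

section Existence

universe u

variable {F : Type u} [Field F] [NumberField F] [IsTotallyReal F] {n : ℕ}

/-- Multiplication of a point of `ℝ ⊗ F` by a totally positive unit. -/
def act (u : totPosUnits F) (t : (F →+* ℝ) → ℝ) : (F →+* ℝ) → ℝ := fun τ => t τ * τ (unitVal u)

theorem pair_act (u : totPosUnits F) (t : (F →+* ℝ) → ℝ) (x : F) :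
    pair (act u t) x = pair t (unitVal u * x) := pair_mul_left _ _ _

theorem act_one (t : (F →+* ℝ) → ℝ) : act 1 t = t := by
  ext τ; simp [act, unitVal_one]

theorem act_mul (u u' : totPosUnits F) (t : (F →+* ℝ) → ℝ) :
    act (u' * u) t = act u' (act u t) := by
  ext τ
  simp only [act, unitVal_mul, map_mul]
  ring

theorem IsGeneric.act {t : (F →+* ℝ) → ℝ} (ht : IsGeneric t) (u : totPosUnits F) :
    IsGeneric (act u t) := fun c hc => by
  rw [pair_act]
  exact ht _ (mul_ne_zero (unitVal_ne_zero u) hc)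

theorem mem_dualRegion_unit (u : totPosUnits F) (w : Fin n → F) (t : (F →+* ℝ) → ℝ) :
    t ∈ (dualRegion fun j => unitVal u * w j) ↔ act u t ∈ dualRegion w :=
  forall_congr' fun j => by rw [pair_act]

/-- The number of translates of the cones in `S` which contain `t`. -/
def coverCount (S : Finset (PosSimplex F n)) (t : (F →+* ℝ) → ℝ) : ℝ≥0∞ :=
  ∑' u : totPosUnits F, ∑ s ∈ S, (s.ind (act u t) : ℝ≥0∞)

theorem coverCount_act (S : Finset (PosSimplex F n)) (u : totPosUnits F) (t : (F →+* ℝ) → ℝ) :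
    coverCount S (act u t) = coverCount S t := by
  unfold coverCount
  rw [← (Equiv.mulRight u).tsum_eq fun u' => ∑ s ∈ S, (s.ind (act u' t) : ℝ≥0∞)]
  simp only [Equiv.coe_mulRight, act_mul]

variable {a : FractionalIdeal (𝓞 F)⁰ F} {w₀ v₀ : Fin n → F}

/-- Only finitely many translates meet `s₀`, bounded by finitely many hyperplanes. Cutting along all
of these makes the multiplicity constant on pieces, and unimodular refinement preserves constancy.
-/
theorem subdivides_coverCount_const (h₀ : IsIntBasis a w₀) (hd : IsTraceDual w₀ v₀)
    (hn : finrank ℚ F = n) (S : Finset (PosSimplex F n)) {s₀ : PosSimplex F n} (hs₀ : s₀ ∈ S) :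
    PosSimplex.Subdivides (fun s => IsIntBasis a s.w ∧ ∃ N : ℕ, N ≠ 0 ∧
      ∀ t, IsGeneric t → t ∈ dualRegion s.w → coverCount S t = N) s₀ := by
  classical
  let E : Finset (totPosUnits F) := S.biUnion fun s => (s₀.finite_units_meeting hn s).toFinset
  have hE {u : totPosUnits F} {s : PosSimplex F n} (hs : s ∈ S) {t : (F →+* ℝ) → ℝ}
      (ht : t ∈ dualRegion s₀.w) (htu : act u t ∈ dualRegion s.w) : u ∈ E :=
    Finset.mem_biUnion.mpr ⟨s, hs, (Set.Finite.mem_toFinset _).mpr ⟨t, ht, htu⟩⟩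
  let cs : Finset F := (E ×ˢ S ×ˢ (Finset.univ : Finset (Fin n))).image
    fun p => unitVal p.1 * p.2.1.w p.2.2
  have hcs {u : totPosUnits F} {s : PosSimplex F n} (hu : u ∈ E) (hs : s ∈ S) (j : Fin n) :
      unitVal u * s.w j ∈ cs :=
    Finset.mem_image.mpr ⟨(u, s, j), by simp [hu, hs], rfl⟩
  have hcount {t : (F →+* ℝ) → ℝ} (ht : t ∈ dualRegion s₀.w) :
      coverCount S t = ((∑ u ∈ E, ∑ s ∈ S, s.ind (act u t) : ℕ) : ℝ≥0∞) := by
    unfold coverCount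
    rw [tsum_eq_sum fun u hu => Finset.sum_eq_zero fun s hs => by
      rw [PosSimplex.ind_of_notMem fun h => hu (hE hs ht h), Nat.cast_zero]]
    push_cast
    rfl
  have h1 := (PosSimplex.subdivides_decides_finset hn cs s₀).mono
    (R' := fun s => (∀ c ∈ cs, PosSimplex.Decides c s) ∧
      ∀ t, IsGeneric t → t ∈ dualRegion s.w → t ∈ dualRegion s₀.w) fun s h hsub => ⟨h, hsub⟩
  refine h1.bind fun s' hs' => (PosSimplex.subdivides_isIntBasis h₀ hd hn s').mono
    fun s h hsub => ⟨h, ?_⟩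
  have hdec (c) (hc : c ∈ cs) : PosSimplex.Decides c s := (hs'.1 c hc).of_subset hsub
  have hsub₀ (t) (ht : IsGeneric t) (hmem : t ∈ dualRegion s.w) : t ∈ dualRegion s₀.w :=
    hs'.2 t ht (hsub t ht hmem)
  by_cases hex : ∃ t₀, IsGeneric t₀ ∧ t₀ ∈ dualRegion s.w
  · obtain ⟨t₀, ht₀, hmem₀⟩ := hex
    have hmem₀' := hsub₀ t₀ ht₀ hmem₀
    refine ⟨∑ u ∈ E, ∑ s ∈ S, s.ind (act u t₀), ?_, fun t ht hmem => ?_⟩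
    · intro h0
      -- The count is nonzero because the trivial translate of `s₀` itself contains the point.
      have h2 := Finset.sum_eq_zero_iff.mp h0 1
        (hE hs₀ hmem₀' (by rw [act_one]; exact hmem₀'))
      have h3 := Finset.sum_eq_zero_iff.mp h2 s₀ hs₀
      rw [act_one, PosSimplex.ind_of_mem hmem₀'] at h3
      exact one_ne_zero h3
    · rw [hcount (hsub₀ t ht hmem)]
      congr 1
      refine Finset.sum_congr rfl fun u hu => Finset.sum_congr rfl fun s'' hs'' => ?_
      have hiff : act u t ∈ dualRegion s''.w ↔ act u t₀ ∈ dualRegion s''.w := by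
        refine forall_congr' fun j => ?_
        rw [pair_act, pair_act]
        rcases hdec _ (hcs hu hs'' j) with h | h
        · exact ⟨fun _ => h t₀ ht₀ hmem₀, fun _ => h t ht hmem⟩
        · exact ⟨fun h' => absurd h' (h t ht hmem), fun h' => absurd h' (h t₀ ht₀ hmem₀)⟩
      by_cases hm : act u t ∈ dualRegion s''.w
      · rw [PosSimplex.ind_of_mem hm, PosSimplex.ind_of_mem (hiff.mp hm)]
      · rw [PosSimplex.ind_of_notMem hm, PosSimplex.ind_of_notMem (mt hiff.mpr hm)]
  · push Not at hex
    -- With no generic point in the piece, any nonzero weight will do.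
    exact ⟨1, one_ne_zero, fun t ht hmem => absurd hmem (hex t ht)⟩

/-- The totally positive orthant admits a weighted partition into unimodular cones. -/
theorem exists_isUnitPartition (h₀ : IsIntBasis a w₀) (hd : IsTraceDual w₀ v₀)
    (hn : finrank ℚ F = n) :
    ∃ (S : Type u) (_ : Fintype S) (σ : S → PosSimplex F n) (N : S → ℕ),
      (∀ s, N s ≠ 0) ∧ (∀ s, IsIntBasis a (σ s).w) ∧ IsUnitPartition (fun s => (σ s).w) N := by
  classical
  obtain ⟨S₀, hS₀⟩ := exists_finite_cover (F := F) hn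
  choose L hL hLsum using fun s : S₀ => subdivides_coverCount_const h₀ hd hn S₀ s.2
  have hget (p : Σ s : S₀, Fin (L s).length) := hL p.1 _ (List.getElem_mem p.2.2)
  choose hbasis N hN hNcount using hget
  refine ⟨Σ s : S₀, Fin (L s).length, inferInstance, fun p => (L p.1)[p.2], N, hN, hbasis,
    fun t ht hgen => ?_⟩
  have hsum (s : S₀) (t) (ht : IsGeneric t) :
      ∑ i : Fin (L s).length, ((L s)[i].ind t : ℝ≥0∞) = (s.1.ind t : ℝ≥0∞) := by
    rw [hLsum s t ht, ← Fin.sum_univ_fun_getElem, Nat.cast_sum]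
    rfl
  have hcount : coverCount S₀ t ≠ 0 ∧ coverCount S₀ t ≠ ⊤ := by
    obtain ⟨u, s, hs, hmem⟩ := hS₀ t ht
    change act u t ∈ _ at hmem
    have h1 := hsum ⟨s, hs⟩ _ (hgen.act u)
    rw [PosSimplex.ind_of_mem hmem, Nat.cast_one] at h1
    obtain ⟨i, -, hi⟩ := Finset.exists_ne_zero_of_sum_ne_zero (h1 ▸ one_ne_zero)
    have hi' := PosSimplex.ind_ne_zero.mp (Nat.cast_ne_zero.mp hi)
    have h2 := hNcount ⟨⟨s, hs⟩, i⟩ (act u t) (hgen.act u) hi'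
    rw [coverCount_act] at h2
    rw [h2]
    exact ⟨Nat.cast_ne_zero.mpr (hN _), ENNReal.natCast_ne_top _⟩
  -- Wherever the indicator is nonzero, `N p` equals the covering number, which is unit invariant.
  -- The weight is thus the same for all translates containing `t`, and the total is that number
  -- times its inverse.
  have hterm (u : totPosUnits F) (p : Σ s : S₀, Fin (L s).length) :
      (N p : ℝ≥0∞)⁻¹ * (dualRegion fun j => unitVal u * (L p.1)[p.2].w j).indicator 1 t =
        (coverCount S₀ t)⁻¹ * ((L p.1)[p.2].ind (act u t) : ℝ≥0∞) := by
    by_cases hmem : act u t ∈ dualRegion (L p.1)[p.2].w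
    · rw [PosSimplex.ind_of_mem hmem, indicator_of_mem ((mem_dualRegion_unit _ _ _).mpr hmem),
        ← hNcount p (act u t) (hgen.act u) hmem, coverCount_act]
      simp
    · rw [PosSimplex.ind_of_notMem hmem,
        indicator_of_notMem (mt (mem_dualRegion_unit _ _ _).mp hmem)]
      simp
  have hu (u : totPosUnits F) : ∑ p : Σ s : S₀, Fin (L s).length,
      (N p : ℝ≥0∞)⁻¹ * (dualRegion fun j => unitVal u * (L p.1)[p.2].w j).indicator 1 t =
        (coverCount S₀ t)⁻¹ * ∑ s ∈ S₀, (s.ind (act u t) : ℝ≥0∞) := by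
    simp only [hterm]
    rw [← Finset.mul_sum, Fintype.sum_sigma]
    congr 1
    rw [← Finset.sum_coe_sort S₀]
    exact Finset.sum_congr rfl fun s _ => hsum s _ (hgen.act u)
  rw [tsum_congr hu, ENNReal.tsum_mul_left]
  exact ENNReal.inv_mul_cancel hcount.1 hcount.2

end Existence

/-! ### From a smooth Shintani decomposition to a unit partition. -/

section Shintani

variable {F : Type*} [Field F] [NumberField F] [IsTotallyReal F] {n : ℕ} {w v : Fin n → F}

/-- The elements `∑ i, (α_j)_i v_i` of `F` attached to the columns `α_j` of a matrix. -/
def combine (v : Fin n → F) (I : Fin n → Fin n → ℤ) (j : Fin n) : F := ∑ i, (I j i : F) * v i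

theorem normPoly_eq_normForm (v : Fin n → F) (I : Fin n → Fin n → ℤ) :
    normPoly v I = normForm (combine v I) := by
  unfold normPoly normForm
  refine Finset.prod_congr rfl fun τ _ => ?_
  simp only [Finset.mul_sum, combine, map_sum, map_mul, map_intCast, Finset.sum_mul]
  rw [Finset.sum_comm]
  exact Finset.sum_congr rfl fun j _ => Finset.sum_congr rfl fun i _ => by ring

theorem dualCone_eq_coneOf (h : IsTraceDual w v) (hn : finrank ℚ F = n)
    (I : Fin n → Fin n → ℤ) : dualCone w I = coneOf (embVec (combine v I)) := by
  have hlin (s : (F →+* ℝ) → ℝ) : (fun j => ∑ i, (I j i : ℝ) * (∑ τ, s τ • embVec v τ) i) =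
      ∑ τ, s τ • embVec (combine v I) τ := by
    ext j
    simp only [Finset.sum_apply, Pi.smul_apply, smul_eq_mul, embVec, combine, map_sum, map_mul,
      map_intCast, Finset.mul_sum]
    rw [Finset.sum_comm]
    exact Finset.sum_congr rfl fun j _ => Finset.sum_congr rfl fun i _ => by ring
  unfold dualCone
  rw [posCone_eq_coneOf h hn]
  ext x
  constructor
  · rintro ⟨_, ⟨s, hs, rfl⟩, rfl⟩
    exact ⟨s, hs, hlin s⟩
  · rintro ⟨s, hs, rfl⟩
    exact ⟨_, ⟨s, hs, rfl⟩, hlin s⟩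

theorem trace_intCast_mul (m : ℤ) (x : F) :
    Algebra.trace ℚ F ((m : F) * x) = (m : ℚ) * Algebra.trace ℚ F x := by
  rw [← smul_eq_mul (m : ℚ), ← map_smul, Algebra.smul_def]
  simp

theorem trace_sum_intCast_mul (h : IsTraceDual w v) (m : Fin n → ℤ) (i : Fin n) :
    Algebra.trace ℚ F (w i * ∑ j, (m j : F) * v j) = m i := by
  rw [Finset.mul_sum, map_sum]
  simp only [mul_left_comm (w i), trace_intCast_mul, h i]
  simp

variable {a : FractionalIdeal (𝓞 F)⁰ F} {Φ : Finset (IntTuple n)}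

theorem mem_topPart {I : Fin n → Fin n → ℤ} : I ∈ topPart Φ ↔ (⟨n, I⟩ : IntTuple n) ∈ Φ := by
  simp [topPart]

theorem combine_pos (h : IsTraceDual w v) (hn : finrank ℚ F = n)
    (hΦ : IsShintaniDecomposition w Φ) {I : Fin n → Fin n → ℤ} (hI : I ∈ topPart Φ) (j : Fin n)
    (τ : F →+* ℝ) : 0 < τ (combine v I j) := by
  have := hΦ.mem_cone _ (mem_topPart.mp hI) j
  rw [← posCone_eq_coneOf h.symm hn] at this
  simpa [combine] using this τ

theorem sum_repr_single_mul (b : Basis (Fin n) ℤ (Fin n → ℤ)) (x : Fin n → ℤ) (k : Fin n) :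
    ∑ i, b.repr (Pi.single i 1) k * x i = b.repr x k := by
  conv_rhs => rw [pi_eq_sum_univ' x]
  rw [map_sum, Finsupp.finsetSum_apply]
  refine Finset.sum_congr rfl fun i _ => ?_
  rw [map_smul, Finsupp.smul_apply, smul_eq_mul, mul_comm]

/-- A full-length extendable tuple is itself a basis of `ℤ^n` up to order, so its inverse matrix is
integral and carries `w` to the dual basis. -/
theorem exists_dual_combine (ha : IsIntBasis a w) (h : IsTraceDual w v) (hn : finrank ℚ F = n)
    (hΦ : IsShintaniDecomposition w Φ) {I : Fin n → Fin n → ℤ} (hI : I ∈ topPart Φ) :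
    ∃ w' : Fin n → F, IsIntBasis a w' ∧ IsTraceDual w' (combine v I) := by
  classical
  obtain ⟨b, e, hb⟩ := hΦ.smooth _ (mem_topPart.mp hI)
  let e' : Fin n ≃ Fin n := Equiv.ofBijective e (Finite.injective_iff_bijective.mp e.injective)
  let b' := b.reindex e'.symm
  have hb' (j : Fin n) : I j = b' j := by
    rw [Basis.reindex_apply]
    exact hb j
  let c : Fin n → Fin n → ℤ := fun j i => b'.repr (Pi.single i 1) j
  let w' : Fin n → F := fun j => ∑ i, (c j i : F) * w i
  have hdual : IsTraceDual w' (combine v I) := by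
    intro j k
    have h1 : Algebra.trace ℚ F (w' j * combine v I k) = ((∑ i, c j i * I k i : ℤ) : ℚ) := by
      simp only [w', Finset.sum_mul, map_sum, mul_assoc, trace_intCast_mul, combine,
        trace_sum_intCast_mul h]
      push_cast
      rfl
    have h2 : ∑ i, c j i * I k i = b'.repr (I k) j := sum_repr_single_mul b' (I k) j
    rw [h1, h2, hb', Basis.repr_self, Finsupp.single_apply]
    simp only [eq_comm (a := j)]
    split_ifs <;> simp
  refine ⟨w', PosSimplex.isIntBasis_of_integral ha h hn hdual (fun i j => ?_)
    (fun i j => ?_), hdual⟩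
  · exact ⟨I j i, trace_sum_intCast_mul h _ _⟩
  · refine ⟨c i j, ?_⟩
    rw [mul_comm]
    exact trace_sum_intCast_mul h.symm _ _

theorem dualCone_eq_posCone {w' : Fin n → F} {I : Fin n → Fin n → ℤ} (h : IsTraceDual w v)
    (h' : IsTraceDual w' (combine v I)) (hn : finrank ℚ F = n) :
    dualCone w I = posCone w' := by
  rw [dualCone_eq_coneOf h hn, posCone_eq_coneOf h' hn]

/-- The point `y = ∑ τ, t_τ τ(w)` of `ℝ^n` with coordinates `t`. -/
def toCoords (w : Fin n → F) (t : (F →+* ℝ) → ℝ) : Fin n → ℝ := fun i => pair t (w i)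

/-- The coordinates `⟨y, τ(v)⟩` of a point of `ℝ^n`. -/
def ofCoords (v : Fin n → F) (y : Fin n → ℝ) : (F →+* ℝ) → ℝ := fun τ => ∑ i, y i * τ (v i)

theorem ofCoords_toCoords (h : IsTraceDual w v) (hn : finrank ℚ F = n) (t : (F →+* ℝ) → ℝ) :
    ofCoords v (toCoords w t) = t :=
  funext fun τ => (h.apply_eq hn t τ).symm

theorem toCoords_ofCoords (h : IsTraceDual w v) (y : Fin n → ℝ) :
    toCoords w (ofCoords v y) = y :=
  funext fun i => h.pair_combination y i

theorem toCoords_mem_coneOf {t : (F →+* ℝ) → ℝ} (ht : t ∈ orthant F) :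
    toCoords w t ∈ coneOf (embVec w) :=
  ⟨t, ht, by ext i; simp [toCoords, pair, embVec]⟩

/-- The matrix `γ` represents multiplication by the unit `u` in the basis `w`. -/
def Represents (w : Fin n → F) (γ : Matrix (Fin n) (Fin n) ℤ) (u : totPosUnits F) : Prop :=
  ∀ x : Fin n → ℤ, ∑ i, ((γ.mulVec x) i : F) * w i = unitVal u * ∑ i, (x i : F) * w i

theorem mem_unitMatrices {γ : Matrix (Fin n) (Fin n) ℤ} :
    γ ∈ unitMatrices w ↔ ∃ u : totPosUnits F, Represents w γ u :=
  ⟨fun ⟨u, hu, h⟩ => ⟨⟨u, hu⟩, h⟩, fun ⟨u, h⟩ => ⟨u.1, u.2, h⟩⟩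

theorem Represents.column {γ : Matrix (Fin n) (Fin n) ℤ} {u : totPosUnits F}
    (hγ : Represents w γ u) (i : Fin n) : ∑ k, (γ k i : F) * w k = unitVal u * w i := by
  classical
  have := hγ (Pi.single i 1)
  simpa [Matrix.mulVec_single, Pi.single_apply] using this

theorem exists_represents (ha : IsIntBasis a w) (u : totPosUnits F) :
    ∃ γ : Matrix (Fin n) (Fin n) ℤ, Represents w γ u := by
  have hmem (i : Fin n) : unitVal u * w i ∈ a := by
    have := (a : Submodule (𝓞 F) F).smul_mem (u.1 : 𝓞 F) (ha.mem i)
    rwa [Algebra.smul_def] at this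
  choose c hc using fun i => (Submodule.mem_span_range_iff_exists_fun ℤ).mp ((ha.2 _).mp (hmem i))
  refine ⟨Matrix.of fun k i => c i k, fun x => ?_⟩
  simp only [Matrix.mulVec, dotProduct, Matrix.of_apply, Int.cast_sum, Int.cast_mul,
    Finset.sum_mul, Finset.mul_sum]
  rw [Finset.sum_comm]
  refine Finset.sum_congr rfl fun i _ => ?_
  rw [mul_left_comm, ← hc i, Finset.mul_sum]
  exact Finset.sum_congr rfl fun k _ => by rw [zsmul_eq_mul]; ring

theorem Represents.unit_unique {γ : Matrix (Fin n) (Fin n) ℤ} {u u' : totPosUnits F}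
    (h : IsTraceDual w v) (hn : finrank ℚ F = n) (hγ : Represents w γ u)
    (hγ' : Represents w γ u') : u = u' := by
  have i : Fin n := ⟨0, hn ▸ finrank_pos⟩
  have hw : w i ≠ 0 := h.linearIndependent.ne_zero i
  exact unitVal_injective (mul_right_cancel₀ hw ((hγ.column i).symm.trans (hγ'.column i)))

theorem Represents.toCoords_act {γ : Matrix (Fin n) (Fin n) ℤ} {u : totPosUnits F}
    (hγ : Represents w γ u) (t : (F →+* ℝ) → ℝ) :
    ((γ.map (Int.cast : ℤ → ℝ)).transpose).mulVec (toCoords w t) = toCoords w (act u t) := by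
  ext i
  rw [toCoords, pair_act, ← hγ.column i, pair_sum]
  change ∑ k, (γ k i : ℝ) * pair t (w k) = _
  refine Finset.sum_congr rfl fun k _ => ?_
  have := pair_ratCast_mul t (γ k i : ℚ) (w k)
  push_cast at this
  rw [this]

/-- In the coordinates `toCoords w`, the transpose of `γ` is multiplication by `u⁻¹`, so membership
in the translate is tested after multiplying by `u`. -/
theorem Represents.mem_coneTranslate {γ : Matrix (Fin n) (Fin n) ℤ} {u : totPosUnits F}
    (h : IsTraceDual w v) (hn : finrank ℚ F = n) (hγ : Represents w γ u⁻¹)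
    (C : Set (Fin n → ℝ)) (t : (F →+* ℝ) → ℝ) :
    toCoords w t ∈ coneTranslate γ C ↔ toCoords w (act u t) ∈ C := by
  constructor
  · rintro ⟨z, hz, hzt⟩
    rw [← toCoords_ofCoords h z] at hzt hz
    have h1 := hzt
    dsimp only at h1
    rw [hγ.toCoords_act] at h1
    have h2 := congrArg (ofCoords v) h1
    rw [ofCoords_toCoords h hn, ofCoords_toCoords h hn] at h2
    rw [← h2, ← act_mul, mul_inv_cancel, act_one]
    exact hz
  · intro hmem
    refine ⟨_, hmem, ?_⟩
    dsimp only
    rw [hγ.toCoords_act, ← act_mul, inv_mul_cancel, act_one]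

theorem toCoords_mem_intCone {w' : Fin n → F} {I : Fin n → Fin n → ℤ} (h : IsTraceDual w v)
    (h' : IsTraceDual w' (combine v I)) (hn : finrank ℚ F = n) (t : (F →+* ℝ) → ℝ) :
    toCoords w t ∈ intCone (⟨n, I⟩ : IntTuple n) ↔ t ∈ dualRegion w' := by
  have hcomb (z : Fin n → ℝ) : ofCoords v (∑ j, z j • fun i => (I j i : ℝ)) =
      fun τ => ∑ j, z j * τ (combine v I j) := by
    ext τ
    simp only [ofCoords, combine, Finset.sum_apply, Pi.smul_apply, smul_eq_mul, Finset.sum_mul,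
      Finset.mul_sum, map_sum, map_mul, map_intCast]
    rw [Finset.sum_comm]
    exact Finset.sum_congr rfl fun j _ => Finset.sum_congr rfl fun i _ => by ring
  rw [dualRegion_eq_image h' hn]
  constructor
  · rintro ⟨z, hz, hzt⟩
    refine ⟨z, hz, ?_⟩
    dsimp only
    rw [← hcomb z, ← ofCoords_toCoords h hn t, hzt]
  · rintro ⟨z, hz, rfl⟩
    refine ⟨z, hz, ?_⟩
    dsimp only
    rw [← hcomb z, toCoords_ofCoords h]

/-- A shorter tuple omits some vector of the extended basis. The coordinate form of that vector is
integral and vanishes on the cone, so it gives a nonzero `c ∈ F` with `⟨t, c⟩ = 0`, against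
genericity. -/
theorem length_eq_of_mem_intCone (ha : IsIntBasis a w)
    (hΦ : IsShintaniDecomposition w Φ) {I : IntTuple n} (hI : I ∈ Φ) {t : (F →+* ℝ) → ℝ}
    (ht : IsGeneric t) (hmem : toCoords w t ∈ intCone I) : I.1 = n := by
  classical
  by_contra hne
  obtain ⟨b, e, hb⟩ := hΦ.smooth I hI
  have hns : ¬ Function.Surjective e := fun hs => hne (by
    simpa using Fintype.card_of_bijective ⟨e.injective, hs⟩)
  simp only [Function.Surjective, not_forall, not_exists] at hns
  obtain ⟨k, hk⟩ := hns
  let m : Fin n → ℤ := fun i => b.repr (Pi.single i 1) k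
  have hm (x : Fin n → ℤ) : ∑ i, m i * x i = b.repr x k := sum_repr_single_mul b x k
  have hc : ∑ i, (m i : F) * w i ≠ 0 := by
    intro h0
    have h1 : ∑ i, m i • w i = 0 := by simpa [zsmul_eq_mul] using h0
    have h2 := Fintype.linearIndependent_iff.mp ha.1 m h1
    have h3 := hm (b k)
    simp [h2] at h3
  refine ht _ hc ?_
  obtain ⟨z, -, hz⟩ := hmem
  have h1 : pair t (∑ i, (m i : F) * w i) = ∑ i, (m i : ℝ) * toCoords w t i := by
    rw [pair_sum]
    refine Finset.sum_congr rfl fun i _ => ?_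
    have := pair_ratCast_mul t (m i : ℚ) (w i)
    push_cast at this
    exact this
  rw [h1, hz]
  simp only [Finset.sum_apply, Pi.smul_apply, smul_eq_mul, Finset.mul_sum]
  rw [Finset.sum_comm]
  refine Finset.sum_eq_zero fun j _ => ?_
  have h2 : ∑ i, m i * I.2 j i = 0 := by
    rw [hm, hb, Basis.repr_self, Finsupp.single_eq_of_ne (fun h => hk j h.symm)]
  have h3 : ∑ i, (m i : ℝ) * (z j * (I.2 j i : ℝ)) = z j * ((∑ i, m i * I.2 j i : ℤ) : ℝ) := by
    push_cast
    rw [Finset.mul_sum]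
    exact Finset.sum_congr rfl fun i _ => by ring
  rw [h3, h2, Int.cast_zero, mul_zero]

/-- The full-dimensional cones of a Shintani decomposition form a partition of the totally
positive orthant modulo units, up to non-generic points. -/
theorem isUnitPartition_of_isShintaniDecomposition (ha : IsIntBasis a w) (h : IsTraceDual w v)
    (hn : finrank ℚ F = n) (hΦ : IsShintaniDecomposition w Φ) {W : topPart Φ → Fin n → F}
    (hW : ∀ I : topPart Φ, IsTraceDual (W I) (combine v I.1)) :
    IsUnitPartition W fun _ => 1 := by
  classical
  intro t ht hgen
  have hmem (u : totPosUnits F) (I : topPart Φ) (hmem : act u t ∈ dualRegion (W I))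
      {γ : Matrix (Fin n) (Fin n) ℤ} (hγ : Represents w γ u⁻¹) :
      toCoords w t ∈ coneTranslate γ (intCone (⟨n, I.1⟩ : IntTuple n)) := by
    rw [hγ.mem_coneTranslate h hn, toCoords_mem_intCone h (hW I) hn]
    exact hmem
  have hcover := toCoords_mem_coneOf (w := w) ht
  rw [hΦ.cover] at hcover
  simp only [mem_iUnion] at hcover
  obtain ⟨γ, hγ, I, hI, hyt⟩ := hcover
  obtain ⟨u₀, hu₀⟩ := mem_unitMatrices.mp hγ
  obtain ⟨u, rfl⟩ : ∃ u, u₀ = u⁻¹ := ⟨u₀⁻¹, (inv_inv u₀).symm⟩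
  have hyt' := (hu₀.mem_coneTranslate h hn _ _).mp hyt
  have hlen := length_eq_of_mem_intCone ha hΦ hI (hgen.act u) hyt'
  obtain ⟨r, I⟩ := I
  obtain rfl : r = n := hlen
  let I' : topPart Φ := ⟨I, mem_topPart.mpr hI⟩
  have hin : act u t ∈ dualRegion (W I') := (toCoords_mem_intCone h (hW I') hn _).mp hyt'
  have huniq (u₁ : totPosUnits F) (I₁ : topPart Φ) (h₁ : act u₁ t ∈ dualRegion (W I₁)) :
      u₁ = u ∧ I₁ = I' := by
    obtain ⟨γ₁, hγ₁⟩ := exists_represents ha u₁⁻¹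
    by_contra hne
    refine Set.disjoint_left.mp (hΦ.disjoint γ₁ (mem_unitMatrices.mpr ⟨_, hγ₁⟩) _
      (mem_topPart.mp I₁.2) γ hγ _ hI fun heq => hne ?_) (hmem u₁ I₁ h₁ hγ₁) hyt
    obtain ⟨h2, h3⟩ := Prod.mk.inj heq
    subst h2
    exact ⟨inv_injective (hγ₁.unit_unique h hn hu₀), Subtype.ext (eq_of_heq (Sigma.mk.inj h3).2)⟩
  rw [tsum_eq_single u, Finset.sum_eq_single I']
  · rw [indicator_of_mem ((mem_dualRegion_unit _ _ _).mpr hin)]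
    simp
  · intro I₁ _ hne
    rw [indicator_of_notMem fun hm => hne (huniq u I₁ ((mem_dualRegion_unit _ _ _).mp hm)).2,
      mul_zero]
  · simp
  · intro u₁ hne
    refine Finset.sum_eq_zero fun I₁ _ => ?_
    rw [indicator_of_notMem fun hm => hne (huniq u₁ I₁ ((mem_dualRegion_unit _ _ _).mp hm)).1,
      mul_zero]

/-- The coefficients are rational, and the exponents `l_j + 1` sum to `n(k-1) + n = nk`. -/
theorem coneValue_mem_span (w v : Fin n → F) {k : ℕ} (hk : 2 ≤ k) {V : Submodule ℚ ℝ}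
    (hV : ∀ l : Fin n → ℕ, (∀ j, 1 ≤ l j) → ∑ j, l j = n * k → conicalZeta (posCone w) l ∈ V) :
    coneValue w v k ∈ V := by
  refine Submodule.sum_mem _ fun l hl => ?_
  obtain ⟨c, hc⟩ := exists_rat_coeff_normForm_pow v (k - 1) (Finsupp.equivFunOnFinite.symm l)
  have : (∏ j, ((l j).factorial : ℝ)) *
      (normForm v ^ (k - 1)).coeff (Finsupp.equivFunOnFinite.symm l) *
        conicalZeta (posCone w) (fun j => l j + 1) =
      ((∏ j, ((l j).factorial : ℚ)) * c) • conicalZeta (posCone w) (fun j => l j + 1) := by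
    rw [hc, Rat.smul_def]
    push_cast
    rfl
  rw [this]
  refine Submodule.smul_mem _ _ (hV _ (fun j => by omega) ?_)
  rw [Finset.mem_piAntidiag] at hl
  rw [Finset.sum_add_distrib, hl.1]
  obtain ⟨k, rfl⟩ : ∃ k', k = k' + 1 := ⟨k - 1, by omega⟩
  simp [mul_add]

end Shintani

end ConicalZeta

end

/-! ### The theorem. -/

theorem theorem2p1 {F : Type*} [Field F] [NumberField F] [NumberField.IsTotallyReal F]
    (n : ℕ) (hn : Module.finrank ℚ F = n)
    (a : FractionalIdeal (nonZeroDivisors (NumberField.RingOfIntegers F)) F) (ha : a ≠ 0) :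
    -- the series defining the partial zeta values converge
    (∀ k : ℕ, 2 ≤ k → Summable (ConicalZeta.partialZetaTerm a (k : ℂ))) ∧
    -- the main assertion
    (∃ (m : ℕ) (C : Fin m → Set (Fin n → ℝ)),
      (∀ i, ConicalZeta.IsTotallyPositive (C i) ∧
        ConicalZeta.IsRationalCone (ConicalZeta.compositum F) (C i) ∧
        ConicalZeta.IsAlgebraicCone (C i)) ∧
      ∀ k : ℕ, 2 ≤ k →
        (∀ i, ∀ l : Fin n → ℕ, (∀ j, 1 ≤ l j) → ∑ j, l j = n * k →
          Summable (ConicalZeta.conicalTerm (C i) l)) ∧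
        ∃ v ∈ Submodule.span ℚ {z : ℝ | ∃ (i : Fin m) (l : Fin n → ℕ),
            (∀ j, 1 ≤ l j) ∧ ∑ j, l j = n * k ∧ z = ConicalZeta.conicalZeta (C i) l},
          ConicalZeta.partialZeta a (k : ℂ) =
            ((1 / √(NumberField.discr F : ℝ) * v : ℝ) : ℂ)) ∧
    -- the explicit formula attached to a Shintani cone decomposition
    (∀ w v : Fin n → F, ConicalZeta.IsIntBasis a w → ConicalZeta.IsTraceDual w v →
      ∀ Φ : Finset (ConicalZeta.IntTuple n), ConicalZeta.IsShintaniDecomposition w Φ →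
        (∀ I ∈ ConicalZeta.topPart Φ,
          ConicalZeta.IsTotallyPositive (ConicalZeta.dualCone w I) ∧
          ConicalZeta.IsRationalCone (ConicalZeta.compositum F) (ConicalZeta.dualCone w I) ∧
          ConicalZeta.IsAlgebraicCone (ConicalZeta.dualCone w I)) ∧
        ∀ k : ℕ, 2 ≤ k →
          (∀ I ∈ ConicalZeta.topPart Φ, ∀ l : Fin n → ℕ, ∑ j, l j = n * (k - 1) →
            Summable (ConicalZeta.conicalTerm (ConicalZeta.dualCone w I) (fun j => l j + 1)) ∧
            ∃ c : ℚ, ConicalZeta.normCoeff v I k l = (c : ℝ)) ∧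
          ConicalZeta.partialZeta a (k : ℂ) =
            ((1 / ((((k - 1).factorial : ℝ) ^ n) * √(NumberField.discr F : ℝ) *
                ((FractionalIdeal.absNorm a : ℚ) : ℝ)) *
              ∑ I ∈ ConicalZeta.topPart Φ,
                ∑ l ∈ Finset.piAntidiag (Finset.univ : Finset (Fin n)) (n * (k - 1)),
                  (∏ j, ((l j).factorial : ℝ)) * ConicalZeta.normCoeff v I k l *
                    ConicalZeta.conicalZeta (ConicalZeta.dualCone w I) (fun j => l j + 1) : ℝ) :
              ℂ)) := by
  classical
  obtain ⟨w₀, h₀⟩ := ConicalZeta.exists_isIntBasis ha hn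
  obtain ⟨v₀, hd₀⟩ := ConicalZeta.exists_dual_of_isIntBasis h₀ hn
  obtain ⟨S, _, s, N, hN, hbasis, hpart⟩ := ConicalZeta.exists_isUnitPartition h₀ hd₀ hn
  have hformula (k : ℕ) (hk : 2 ≤ k) := ConicalZeta.partialZeta_of_isUnitPartition hN hbasis
    (fun i => (s i).dual) hn (fun i => (s i).pos) hpart hk
  have hn0 : 0 < n := hn ▸ finrank_pos
  refine ⟨fun k hk => (hformula k hk).1, ?_, ?_⟩
  · let e := Fintype.equivFin S
    refine ⟨Fintype.card S, fun i => ConicalZeta.posCone (s (e.symm i)).w, fun i => ?_,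
      fun k hk => ⟨fun i l _ hl => ?_, ?_⟩⟩
    · have hrat := ConicalZeta.isRationalCone_posCone (s (e.symm i)).dual hn
      exact ⟨ConicalZeta.isTotallyPositive_posCone (s (e.symm i)).dual hn (s (e.symm i)).pos, hrat,
        ConicalZeta.isAlgebraicCone_of_compositum hrat⟩
    · refine ConicalZeta.summable_conicalTerm (s (e.symm i)).dual hn (s (e.symm i)).pos ?_
      rw [hl]
      nlinarith
    -- The factorials, the ideal norm and the weights `1/N` are rational and are absorbed into the
    -- span, so only `1/√d_F` remains outside.
    · refine ⟨(1 / ((((k - 1).factorial : ℚ) ^ n) * FractionalIdeal.absNorm a) : ℚ) •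
        ∑ i, ((N i : ℚ)⁻¹) • ConicalZeta.coneValue (s i).w (s i).v k, ?_, ?_⟩
      · refine Submodule.smul_mem _ _ (Submodule.sum_mem _ fun i _ => Submodule.smul_mem _ _
          (ConicalZeta.coneValue_mem_span _ _ hk fun l hl1 hl => ?_))
        exact Submodule.subset_span ⟨e i, l, hl1, hl, by simp⟩
      · rw [(hformula k hk).2]
        congr 1
        simp only [Rat.smul_def]
        push_cast
        simp only [one_div, mul_inv]
        ring
  · intro w v hw hv Φ hΦ
    choose W hWbasis hWdual using fun I : ConicalZeta.topPart Φ =>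
      ConicalZeta.exists_dual_combine hw hv hn hΦ I.2
    have hpos (I : ConicalZeta.topPart Φ) := ConicalZeta.combine_pos hv hn hΦ I.2
    have hcone (I : ConicalZeta.topPart Φ) := ConicalZeta.dualCone_eq_posCone hv (hWdual I) hn
    refine ⟨fun I hI => ?_, fun k hk => ⟨fun I hI l hl => ⟨?_, ?_⟩, ?_⟩⟩
    · rw [hcone ⟨I, hI⟩]
      have hrat := ConicalZeta.isRationalCone_posCone (hWdual ⟨I, hI⟩) hn
      exact ⟨ConicalZeta.isTotallyPositive_posCone (hWdual ⟨I, hI⟩) hn (hpos ⟨I, hI⟩), hrat,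
        ConicalZeta.isAlgebraicCone_of_compositum hrat⟩
    · rw [hcone ⟨I, hI⟩]
      refine ConicalZeta.summable_conicalTerm (hWdual ⟨I, hI⟩) hn (hpos ⟨I, hI⟩) ?_
      rw [Finset.sum_add_distrib, hl]
      have : 0 < n * (k - 1) := Nat.mul_pos hn0 (by omega)
      simp only [Finset.sum_const, Finset.card_univ, Fintype.card_fin, smul_eq_mul]
      omega
    · rw [ConicalZeta.normCoeff, ConicalZeta.normPoly_eq_normForm]
      exact ConicalZeta.exists_rat_coeff_normForm_pow _ _ _
    · rw [(ConicalZeta.partialZeta_of_isUnitPartition (fun _ => one_ne_zero) hWbasis hWdual hn hpos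
        (ConicalZeta.isUnitPartition_of_isShintaniDecomposition hw hv hn hΦ hWdual) hk).2]
      congr 2
      rw [← Finset.sum_coe_sort (ConicalZeta.topPart Φ)]
      refine Finset.sum_congr rfl fun I _ => ?_
      rw [Nat.cast_one, inv_one, one_mul, ConicalZeta.coneValue]
      simp only [ConicalZeta.normCoeff, ConicalZeta.normPoly_eq_normForm, hcone I]
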